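/- **Theorem 3.1.** Let $n,p\ge 1$ be integers, $\beta\in\mathbb R^p$, $\sigma>0$ and $\epsilon\in[0,1/2)$. Suppose that $(X_1,y_1),\dots,(X_n,y_n)\in\mathbb R^p\times\mathbb R$ are independent draws from the adaptive response-contamination model $$X_i\sim\mathcal N(0,I_p),\qquad y_i\mid X_i\sim(1-\epsilon)\,\mathcal N(X_i^\top\beta,\sigma^2)+\epsilon\,Q_{X_i},$$ where $Q_x$ is an arbitrary conditional distribution (probability kernel) that may depend on $x$. For $t\ge 0$ and $\tilde\beta\in\mathbb R^p$ define the empirical truncated regression depth $$\mathcal D(\tilde\beta,\mathbb P_n,t)=\inf_{v\in\mathbb R^p,\ \|v\|_2=1}\ \frac1n\sum_{i=1}^n\mathbf 1\bigl\{v^\top X_i\,(y_i-X_i^\top\tilde\beta)\ge 0,\ |v^\top X_i|\ge t\bigr\},$$ and let $\hat\beta$ be any maximizer of $\tilde\beta\mapsto\mathcal D(\tilde\beta,\mathbb P_n,t)$ over $\mathbb R^p$. For every $\alpha\in(0,1)$ there exist constants $C,c>0$, depending only on $\alpha$, such that whenever $\sqrt{p/n}+\epsilon\le c$ the following hold. 1.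 For every $t$ with $0<t\le\sqrt{0.4\log(n/p)}$, with probability at least $1-\alpha$, $$\|\hat\beta-\beta\|_2\le C\,\frac{\sigma}{t}\left(\sqrt{\frac pn}\,e^{t^2}+\epsilon\right).$$ 2. For the choice $t=\tfrac12\sqrt{\log(n\epsilon^2/p+e)}$, with probability at least $1-\alpha$, $$\|\hat\beta-\beta\|_2\le C\,\sigma\left(\sqrt{\frac pn}+\frac{\epsilon}{\sqrt{\log(n\epsilon^2/p+e)}}\right).$$ -/

import Mathlib

open MeasureTheory ProbabilityTheory
open scoped ENNReal NNReal

noncomputable section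

/-- The conditional law of the response given the covariate under adaptive contamination,
`x ↦ (1 - ε) N(xᵀβ, σ²) + ε Q_x`, as a kernel. Here `Q` is an arbitrary kernel of
contaminating laws, which may depend on the covariate. -/
def responseKernel {p : ℕ} (β : EuclideanSpace ℝ (Fin p)) (σ ε : ℝ)
    (Q : Kernel (EuclideanSpace ℝ (Fin p)) ℝ) : Kernel (EuclideanSpace ℝ (Fin p)) ℝ where
  toFun x := ENNReal.ofReal (1 - ε) • gaussianReal (inner ℝ x β) (Real.toNNReal (σ ^ 2))
    + ENNReal.ofReal ε • Q x
  measurable' := by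
    have hpair : Measurable fun x : EuclideanSpace ℝ (Fin p) =>
        ((inner ℝ x β : ℝ), Real.toNNReal (σ ^ 2)) := by fun_prop
    have hg : Measurable fun x : EuclideanSpace ℝ (Fin p) =>
        gaussianReal (inner ℝ x β) (Real.toNNReal (σ ^ 2)) :=
      measurable_gaussianReal.comp hpair
    refine Measure.measurable_of_measurable_coe _ fun s hs => ?_
    have h1 := (Measure.measurable_coe hs).comp hg
    have h2 := Q.measurable_coe hs
    simp only [Measure.coe_add, Measure.coe_smul, Pi.add_apply, Pi.smul_apply, smul_eq_mul]
    exact (h1.const_mul _).add (h2.const_mul _)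

/-- The mixture is a probability kernel, so that the joint law below is a genuine one. -/
theorem isMarkovKernel_responseKernel {p : ℕ} (β : EuclideanSpace ℝ (Fin p)) (σ ε : ℝ)
    (Q : Kernel (EuclideanSpace ℝ (Fin p)) ℝ) [IsMarkovKernel Q] (h0 : 0 ≤ ε) (h1 : ε ≤ 1) :
    IsMarkovKernel (responseKernel β σ ε Q) := by
  refine ⟨fun x => ⟨?_⟩⟩
  change (ENNReal.ofReal (1 - ε) • gaussianReal (inner ℝ x β) (Real.toNNReal (σ ^ 2))
    + ENNReal.ofReal ε • Q x) Set.univ = 1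
  simp only [Measure.coe_add, Measure.coe_smul, Pi.add_apply, Pi.smul_apply, smul_eq_mul,
    measure_univ, mul_one]
  rw [← ENNReal.ofReal_add (by linarith) h0]
  simp

/-- The joint law of one pair `(X, y)`: `X ~ N(0, I_p)` and
`y | X ~ (1 - ε) N(Xᵀβ, σ²) + ε Q_X`. -/
def adaptiveLaw {p : ℕ} (β : EuclideanSpace ℝ (Fin p)) (σ ε : ℝ)
    (Q : Kernel (EuclideanSpace ℝ (Fin p)) ℝ) : Measure (EuclideanSpace ℝ (Fin p) × ℝ) :=
  stdGaussian (EuclideanSpace ℝ (Fin p)) ⊗ₘ responseKernel β σ ε Q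

/-- The pairs `(X i, y i)`, `i : Fin n`, are independent draws from the adaptive
response-contamination model. -/
structure IsAdaptiveSample {n p : ℕ} {Ω : Type*} [MeasurableSpace Ω] (μ : Measure Ω)
    (β : EuclideanSpace ℝ (Fin p)) (σ ε : ℝ) (Q : Kernel (EuclideanSpace ℝ (Fin p)) ℝ)
    (X : Fin n → Ω → EuclideanSpace ℝ (Fin p)) (y : Fin n → Ω → ℝ) : Prop where
  hasLaw : ∀ i, HasLaw (fun ω => (X i ω, y i ω)) (adaptiveLaw β σ ε Q) μ
  indep : iIndepFun (fun i ω => (X i ω, y i ω)) μ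

/-- The set of pairs `(x, y)` with `vᵀx (y - xᵀb) ≥ 0` and `|vᵀx| ≥ t`. -/
def truncSet {p : ℕ} (v b : EuclideanSpace ℝ (Fin p)) (t : ℝ) :
    Set (EuclideanSpace ℝ (Fin p) × ℝ) :=
  {z | 0 ≤ inner ℝ v z.1 * (z.2 - inner ℝ z.1 b) ∧ t ≤ |inner ℝ v z.1|}

/-- The empirical truncated regression depth of `b`: the infimum over unit vectors `v` of the
fraction of the data points `(x i, y i)` that lie in `truncSet v b t`. -/
def empTruncDepth {n p : ℕ} (x : Fin n → EuclideanSpace ℝ (Fin p)) (y : Fin n → ℝ)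
    (t : ℝ) (b : EuclideanSpace ℝ (Fin p)) : ℝ :=
  ⨅ v : Metric.sphere (0 : EuclideanSpace ℝ (Fin p)) 1,
    (1 / (n : ℝ)) * ∑ i, (truncSet (v : EuclideanSpace ℝ (Fin p)) b t).indicator
      (fun _ => (1 : ℝ)) (x i, y i)

/-- `b` is a maximizer of the empirical truncated regression depth. Maximizers need not be
unique. -/
def IsDepthMaximizer {n p : ℕ} (x : Fin n → EuclideanSpace ℝ (Fin p)) (y : Fin n → ℝ)
    (t : ℝ) (b : EuclideanSpace ℝ (Fin p)) : Prop :=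
  ∀ b' : EuclideanSpace ℝ (Fin p), empTruncDepth x y t b' ≤ empTruncDepth x y t b

end

/-! The depth at the truth is compared with the depth at any `b` farther than `R` from `β`. Let q be
the probability that |g| ≥ t for standard normal g. At `β`, in every direction v, the depth counts
all points whose residual sign times vᵀx is at least t. Given x, the clean residual sign is a fair
coin, so this cap has mass at least (1 - ε)q/2. At `b`, test the direction v of b - β: a counted
point must have a residual at `β` exceeding `R * t` in absolute value, with the sign of vᵀx. For `R
* t ≤ σ` this lowers 1/2 by `R * t / (6σ)`, while contamination adds at most εq, since it can only
act on |vᵀx| ≥ t. If empirical and population masses differ by at most δ, a maximizer with error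
above `R` forces q R t / (12σ) ≤ εq + 2δ (`norm_sub_le_of_isDepthMaximizer`). As 1/q is at most a
constant times exp(t²) and δ is of order √(p/n), this yields the rate.

Truncation also reduces the empirical process: both families are caps {t ≤ s(z) vᵀx} with a fixed
sign function s, so only v on the sphere varies and `b` disappears. `exists_uniform_deviation`
bounds them by chaining at rate √(p/n). Two caps differ only on a thin strip around |vᵀx| = t or
where the directions disagree much (`abs_capInd_sub_le`). Hence nets at scale 8^(-k) give increments
of L¹ norm O(4^(-k)), and Bernstein's inequality gives deviations of order √(p/n) (k + 1) 2^(-k),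
which are summable. The chain stops when 2^(-k) is comparable to √(p/n); the remainder is controlled
by empirical strip masses and by a uniform bound on ∑ |uᵀxᵢ|. -/

noncomputable section

/-! ### Nets of the ball and the sphere -/

section Nets

/-- The unit ball of `ℝᵖ` is covered by `5 ^ p` balls of radius `1 / 2`. -/
theorem exists_halfCover (p : ℕ) : ∃ N : Finset (EuclideanSpace ℝ (Fin p)),
    N.card ≤ 5 ^ p ∧ ∀ x : EuclideanSpace ℝ (Fin p), ‖x‖ ≤ 1 → ∃ a ∈ N, ‖x - a‖ ≤ 1 / 2 := by
  classical
  let E := EuclideanSpace ℝ (Fin p)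
  let P : Finset E → Prop := fun s => (∀ c ∈ s, ‖c‖ ≤ 2) ∧
    ∀ c ∈ s, ∀ d ∈ s, c ≠ d → 1 ≤ ‖c - d‖
  have hcard : ∀ s, P s → s.card ≤ 5 ^ p := fun s hs => by
    simpa [E] using Besicovitch.card_le_of_separated s hs.1 hs.2
  let S : Set ℕ := {k | ∃ s, P s ∧ s.card = k}
  have hne : S.Nonempty := ⟨0, ∅, by simp [P], by simp⟩
  have hbdd : BddAbove S := ⟨5 ^ p, by rintro k ⟨s, hs, rfl⟩; exact hcard s hs⟩
  obtain ⟨s, hs, hmax⟩ := Nat.sSup_mem hne hbdd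
  -- A separated set of maximal size is a cover, since an uncovered point could be added to it.
  have hcov : ∀ x : E, ‖x‖ ≤ 2 → ∃ a ∈ s, ‖x - a‖ ≤ 1 := by
    intro x hx
    by_contra! hfar
    have hxs : x ∉ s := fun h => by have := hfar x h; simp at this; linarith
    have hP : P (insert x s) := by
      refine ⟨?_, ?_⟩
      · intro c hc
        rcases Finset.mem_insert.1 hc with rfl | hc
        · exact hx
        · exact hs.1 c hc
      · intro c hc d hd hcd
        rcases Finset.mem_insert.1 hc with hcx | hc <;>
          rcases Finset.mem_insert.1 hd with hdx | hd
        · exact absurd (hcx.trans hdx.symm) hcd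
        · rw [hcx]; exact (hfar d hd).le
        · rw [hdx, norm_sub_rev]; exact (hfar c hc).le
        · exact hs.2 c hc d hd hcd
    have hle := le_csSup hbdd (show (insert x s).card ∈ S from ⟨_, hP, rfl⟩)
    rw [Finset.card_insert_of_notMem hxs] at hle
    omega
  refine ⟨s.image (fun a => (1 / 2 : ℝ) • a), Finset.card_image_le.trans (hcard s hs), ?_⟩
  intro x hx
  obtain ⟨a, ha, hxa⟩ := hcov ((2 : ℝ) • x) (by rw [norm_smul]; norm_num; linarith)
  refine ⟨(1 / 2 : ℝ) • a, Finset.mem_image_of_mem _ ha, ?_⟩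
  have : x - (1 / 2 : ℝ) • a = (1 / 2 : ℝ) • ((2 : ℝ) • x - a) := by
    rw [smul_sub, smul_smul]; norm_num
  rw [this, norm_smul]
  norm_num
  linarith

/-- The half-cover is iterated: the error left by a net of scale 2^(-j), rescaled to the unit ball,
is approximated again. Each halving costs a factor 5^p. -/
theorem exists_ballCover (p j : ℕ) : ∃ N : Finset (EuclideanSpace ℝ (Fin p)),
    N.card ≤ 5 ^ (p * j) ∧
      ∀ x : EuclideanSpace ℝ (Fin p), ‖x‖ ≤ 1 → ∃ a ∈ N, ‖x - a‖ ≤ (1 / 2) ^ j := by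
  classical
  obtain ⟨N₀, hN₀, hc₀⟩ := exists_halfCover p
  induction j with
  | zero => exact ⟨{0}, by simp, fun x hx => ⟨0, by simp, by simpa using hx⟩⟩
  | succ j ih =>
    obtain ⟨N, hN, hc⟩ := ih
    refine ⟨Finset.image₂ (fun a b => a + ((1 / 2 : ℝ) ^ j) • b) N N₀, ?_, ?_⟩
    · refine (Finset.card_image₂_le _ _ _).trans ?_
      rw [Nat.mul_succ, pow_add]
      exact Nat.mul_le_mul hN hN₀
    · intro x hx
      obtain ⟨a, ha, hxa⟩ := hc x hx
      have hpos : (0 : ℝ) < (1 / 2) ^ j := by positivity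
      obtain ⟨b, hb, hxb⟩ := hc₀ (((1 / 2 : ℝ) ^ j)⁻¹ • (x - a)) (by
        rw [norm_smul, norm_inv, Real.norm_of_nonneg hpos.le]
        exact inv_mul_le_one_of_le₀ hxa hpos.le)
      refine ⟨_, Finset.mem_image₂_of_mem ha hb, ?_⟩
      have : x - (a + ((1 / 2 : ℝ) ^ j) • b)
          = ((1 / 2 : ℝ) ^ j) • (((1 / 2 : ℝ) ^ j)⁻¹ • (x - a) - b) := by
        rw [smul_sub, smul_smul, mul_inv_cancel₀ hpos.ne', one_smul]; abel
      rw [this, norm_smul, Real.norm_of_nonneg hpos.le, pow_succ]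
      exact mul_le_mul_of_nonneg_left hxb hpos.le

/-- Each useful centre of a ball net is replaced by a nearby unit vector. This doubles the radius,
hence the net of the ball is taken one level finer. -/
theorem exists_sphereCover (p j : ℕ) : ∃ N : Finset (EuclideanSpace ℝ (Fin p)),
    N.card ≤ 5 ^ (p * (j + 1)) ∧ (∀ a ∈ N, ‖a‖ = 1) ∧
      ∀ x : EuclideanSpace ℝ (Fin p), ‖x‖ = 1 → ∃ a ∈ N, ‖x - a‖ ≤ (1 / 2) ^ j := by
  classical
  obtain ⟨N, hN, hc⟩ := exists_ballCover p (j + 1)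
  let P : EuclideanSpace ℝ (Fin p) → EuclideanSpace ℝ (Fin p) → Prop :=
    fun a b => ‖b‖ = 1 ∧ ‖b - a‖ ≤ (1 / 2) ^ (j + 1)
  let g : EuclideanSpace ℝ (Fin p) → EuclideanSpace ℝ (Fin p) :=
    fun a => if h : ∃ b, P a b then h.choose else 0
  have hg : ∀ a, (∃ b, P a b) → P a (g a) := fun a h => by
    simp only [g, dif_pos h]; exact h.choose_spec
  refine ⟨(N.filter fun a => ∃ b, P a b).image g,
    Finset.card_image_le.trans ((Finset.card_filter_le _ _).trans hN), ?_, ?_⟩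
  · intro b hb
    obtain ⟨a, ha, rfl⟩ := Finset.mem_image.1 hb
    exact (hg a (Finset.mem_filter.1 ha).2).1
  · intro x hx
    obtain ⟨a, ha, hxa⟩ := hc x hx.le
    have hex : ∃ b, P a b := ⟨x, hx, hxa⟩
    refine ⟨g a, Finset.mem_image_of_mem _ (Finset.mem_filter.2 ⟨ha, hex⟩), ?_⟩
    calc ‖x - g a‖ = ‖(x - a) - (g a - a)‖ := by congr 1; abel
      _ ≤ ‖x - a‖ + ‖g a - a‖ := norm_sub_le _ _
      _ ≤ (1 / 2) ^ (j + 1) + (1 / 2) ^ (j + 1) := add_le_add hxa (hg a hex).2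
      _ = (1 / 2) ^ j := by ring

end Nets

/-! ### Bernstein's inequality for finite families -/

section Bernstein

/-- The mean of `h` over the points `z i`. -/
def empMean {n : ℕ} {Z : Type*} (z : Fin n → Z) (h : Z → ℝ) : ℝ :=
  (1 / (n : ℝ)) * ∑ i, h (z i)

variable {n : ℕ} {Z Ω : Type*} [MeasurableSpace Z] [MeasurableSpace Ω]

/-- From exp u ≤ 1 + u + u² for |u| ≤ 1 and h² ≤ |h|: the L¹ norm serves as variance proxy, which
suits differences of indicators. -/
theorem mgf_le_of_abs_le_one (ν : Measure Z) [IsProbabilityMeasure ν] {h : Z → ℝ}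
    (hm : Measurable h) (h1 : ∀ z, |h z| ≤ 1) {τ l : ℝ} (hτ : ∫ z, |h z| ∂ν ≤ τ)
    (hl0 : 0 ≤ l) (hl1 : l ≤ 1) :
    ∫ z, Real.exp (l * h z) ∂ν ≤ Real.exp (l * ∫ z, h z ∂ν + l ^ 2 * τ) := by
  have hi : Integrable h ν := Integrable.of_bound hm.aestronglyMeasurable 1 (.of_forall h1)
  have hpt : ∀ z, Real.exp (l * h z) ≤ 1 + l * h z + l ^ 2 * |h z| := by
    intro z
    have habs : |l * h z| ≤ 1 := by
      rw [abs_mul, abs_of_nonneg hl0]; exact mul_le_one₀ hl1 (abs_nonneg _) (h1 z)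
    have h2 := (abs_le.1 (Real.abs_exp_sub_one_sub_id_le habs)).2
    have h3 : (l * h z) ^ 2 ≤ l ^ 2 * |h z| := by
      rw [mul_pow, ← sq_abs (h z)]
      exact mul_le_mul_of_nonneg_left (by nlinarith [h1 z, abs_nonneg (h z)]) (sq_nonneg l)
    linarith
  calc ∫ z, Real.exp (l * h z) ∂ν ≤ ∫ z, (1 + l * h z + l ^ 2 * |h z|) ∂ν := by
        refine integral_mono ?_ ?_ hpt
        · refine Integrable.of_bound (by fun_prop) (Real.exp 1) (.of_forall fun z => ?_)
          rw [Real.norm_of_nonneg (Real.exp_pos _).le, Real.exp_le_exp]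
          have := (abs_le.1 (h1 z)).2
          nlinarith
        · exact ((integrable_const _).add (hi.const_mul _)).add (hi.abs.const_mul _)
    _ = 1 + l * ∫ z, h z ∂ν + l ^ 2 * ∫ z, |h z| ∂ν := by
        have e1 : ∫ z, (1 + l * h z) ∂ν = 1 + l * ∫ z, h z ∂ν := by
          rw [integral_add (integrable_const _) (hi.const_mul _), integral_const_mul]
          simp
        have hi2 : Integrable (fun z => 1 + l * h z) ν :=
          (integrable_const _).add (hi.const_mul _)
        rw [integral_add hi2 (hi.abs.const_mul _), e1, integral_const_mul]
    _ ≤ 1 + (l * ∫ z, h z ∂ν + l ^ 2 * τ) := by nlinarith [sq_nonneg l]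
    _ ≤ _ := by linarith [Real.add_one_le_exp (l * ∫ z, h z ∂ν + l ^ 2 * τ)]

variable {μ : Measure Ω} [IsProbabilityMeasure μ] {ν : Measure Z} {W : Fin n → Ω → Z}

/-- Exponential Markov inequality for a sum of independent copies. -/
theorem measure_sum_ge_le (hW : ∀ i, HasLaw (W i) ν μ) (hind : iIndepFun W μ) {h : Z → ℝ}
    (hm : Measurable h) {l : ℝ} (hl : 0 ≤ l) (hi : Integrable (fun z => Real.exp (l * h z)) ν)
    (a : ℝ) {b : ℝ} (hb : ∫ z, Real.exp (l * h z) ∂ν ≤ Real.exp b) :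
    μ {ω | a ≤ ∑ i, h (W i ω)} ≤ ENNReal.ofReal (Real.exp (-l * a + n * b)) := by
  have hind' : iIndepFun (fun i ω => h (W i ω)) μ := hind.comp (fun _ => h) (fun _ => hm)
  have hWm : ∀ i, AEMeasurable (W i) μ := fun i => (hW i).aemeasurable
  have hmeas : ∀ i, AEMeasurable (fun ω => h (W i ω)) μ := fun i => hm.comp_aemeasurable (hWm i)
  have hmgf : ∀ i, mgf (fun ω => h (W i ω)) μ l = ∫ z, Real.exp (l * h z) ∂ν := fun i => by
    rw [mgf, ← (hW i).integral_comp (f := fun z => Real.exp (l * h z)) hi.aestronglyMeasurable]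
    rfl
  have hint : ∀ i ∈ (Finset.univ : Finset (Fin n)),
      Integrable (fun ω => Real.exp (l * h (W i ω))) μ := fun i _ => by
    have := (hW i).map_eq ▸ hi
    exact this.comp_aemeasurable (hWm i)
  -- A non-integrable exponential would give the value 0 to the moment generating function, but by
  -- independence it is a product of positive factors.
  have hsum : Integrable (fun ω => Real.exp (l * (∑ i, fun ω => h (W i ω)) ω)) μ := by
    by_contra hcon
    have h0 := mgf_undef hcon
    rw [hind'.mgf_sum₀ hmeas] at h0
    exact (Finset.prod_pos fun i hi => mgf_pos (hint i hi)).ne' h0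
  have key := measure_ge_le_exp_mul_mgf (μ := μ) a hl hsum
  rw [hind'.mgf_sum₀ hmeas] at key
  have hprod : ∏ i : Fin n, mgf (fun ω => h (W i ω)) μ l ≤ Real.exp (n * b) := by
    simp_rw [hmgf]
    rw [Finset.prod_const, Finset.card_univ, Fintype.card_fin, Real.exp_nat_mul]
    exact pow_le_pow_left₀ (integral_nonneg fun _ => (Real.exp_pos _).le) hb n
  have hset : {ω | a ≤ ∑ i, h (W i ω)} = {ω | a ≤ (∑ i, fun ω => h (W i ω)) ω} := by
    ext ω; simp
  rw [hset, ← ofReal_measureReal, Real.exp_add]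
  exact ENNReal.ofReal_le_ofReal
    (key.trans (mul_le_mul_of_nonneg_left hprod (Real.exp_pos _).le))

/-- The threshold is the one at which the Chernoff exponent equals -L exactly. Leaving `l` free lets
each chaining level balance the two terms. -/
theorem measure_empMean_sub_gt_le (hn : 0 < n) (hW : ∀ i, HasLaw (W i) ν μ)
    (hind : iIndepFun W μ) {h : Z → ℝ} (hm : Measurable h) (h1 : ∀ z, |h z| ≤ 1) {τ l L : ℝ}
    (hτ : ∫ z, |h z| ∂ν ≤ τ) (hl0 : 0 < l) (hl1 : l ≤ 1) :
    μ {ω | l * τ + L / (n * l) < empMean (fun i => W i ω) h - ∫ z, h z ∂ν}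
      ≤ ENNReal.ofReal (Real.exp (-L)) := by
  have hn' : (0 : ℝ) < n := by exact_mod_cast hn
  have hν : IsProbabilityMeasure ν :=
    (hW ⟨0, hn⟩).isProbabilityMeasure_iff.1 inferInstance
  have hi : Integrable (fun z => Real.exp (l * h z)) ν := by
    refine Integrable.of_bound (by fun_prop) (Real.exp 1) (.of_forall fun z => ?_)
    rw [Real.norm_of_nonneg (Real.exp_pos _).le, Real.exp_le_exp]
    have := (abs_le.1 (h1 z)).2
    nlinarith
  have key := measure_sum_ge_le hW hind hm hl0.le hi
    (n * (∫ z, h z ∂ν + (l * τ + L / (n * l)))) (mgf_le_of_abs_le_one ν hm h1 hτ hl0.le hl1)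
  refine (measure_mono ?_).trans (key.trans (le_of_eq ?_))
  · intro ω hω
    simp only [Set.mem_ofPred_eq, empMean] at hω ⊢
    have : (1 / (n : ℝ)) * ∑ i, h (W i ω) = (∑ i, h (W i ω)) / n := by ring
    rw [this, lt_sub_iff_add_lt, lt_div_iff₀ hn'] at hω
    linarith
  · congr 2
    field_simp
    ring

/-- Bernstein's inequality with a free parameter `l`, for a finite family of functions. -/
theorem measure_exists_abs_empMean_sub_gt_le (hn : 0 < n) (hW : ∀ i, HasLaw (W i) ν μ)
    (hind : iIndepFun W μ) (H : Finset (Z → ℝ)) {τ l L : ℝ}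
    (hH : ∀ h ∈ H, Measurable h ∧ (∀ z, |h z| ≤ 1) ∧ ∫ z, |h z| ∂ν ≤ τ)
    (hl0 : 0 < l) (hl1 : l ≤ 1) :
    μ {ω | ∃ h ∈ H, l * τ + L / (n * l) < |empMean (fun i => W i ω) h - ∫ z, h z ∂ν|}
      ≤ ENNReal.ofReal (H.card * (2 * Real.exp (-L))) := by
  have hset : {ω | ∃ h ∈ H, l * τ + L / (n * l) < |empMean (fun i => W i ω) h - ∫ z, h z ∂ν|}
      ⊆ ⋃ h ∈ H, {ω | l * τ + L / (n * l) < |empMean (fun i => W i ω) h - ∫ z, h z ∂ν|} := by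
    rintro ω ⟨h, hh, hω⟩
    exact Set.mem_biUnion hh hω
  refine (measure_mono hset).trans ((measure_biUnion_finset_le _ _).trans ?_)
  have hone : ∀ h ∈ H,
      μ {ω | l * τ + L / (n * l) < |empMean (fun i => W i ω) h - ∫ z, h z ∂ν|}
        ≤ ENNReal.ofReal (2 * Real.exp (-L)) := by
    intro h hh
    obtain ⟨hm, hb, hi⟩ := hH h hh
    have h1 := measure_empMean_sub_gt_le (L := L) hn hW hind hm hb hi hl0 hl1
    have h2 := measure_empMean_sub_gt_le (L := L) (h := fun z => -h z) hn hW hind hm.neg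
      (by simpa using hb) (by simpa using hi) hl0 hl1
    have hsub : {ω | l * τ + L / (n * l) < |empMean (fun i => W i ω) h - ∫ z, h z ∂ν|}
        ⊆ {ω | l * τ + L / (n * l) < empMean (fun i => W i ω) h - ∫ z, h z ∂ν} ∪
          {ω | l * τ + L / (n * l) <
            empMean (fun i => W i ω) (fun z => -h z) - ∫ z, -h z ∂ν} := by
      intro ω hω
      rw [Set.mem_ofPred_eq, lt_abs] at hω
      rcases hω with h3 | h3
      · exact Or.inl h3
      · right
        simp only [Set.mem_ofPred_eq, empMean, Finset.sum_neg_distrib, integral_neg] at h3 ⊢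
        linarith
    refine (measure_mono hsub).trans ((measure_union_le _ _).trans ((add_le_add h1 h2).trans ?_))
    rw [← ENNReal.ofReal_add (Real.exp_pos _).le (Real.exp_pos _).le, two_mul]
  refine (Finset.sum_le_sum hone).trans ?_
  rw [Finset.sum_const, nsmul_eq_mul, ENNReal.ofReal_mul (p := (H.card : ℝ)) (by positivity),
    ENNReal.ofReal_natCast]

end Bernstein

/-! ### Estimates for the standard normal law on the line -/

section RealGaussian

theorem gaussianPDFReal_zero_one_le (x : ℝ) : gaussianPDFReal 0 1 x ≤ 1 / 2 := by
  have h2 : (2 : ℝ) ≤ √(2 * Real.pi) := by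
    apply Real.le_sqrt_of_sq_le; nlinarith [Real.pi_gt_three]
  have h3 : (√(2 * Real.pi))⁻¹ ≤ 1 / 2 := by
    rw [one_div]; exact inv_anti₀ (by norm_num) h2
  have h4 : Real.exp (-x ^ 2 / 2) ≤ 1 := Real.exp_le_one_iff.2 (by nlinarith [sq_nonneg x])
  simp only [gaussianPDFReal, NNReal.coe_one, mul_one, sub_zero]
  calc _ ≤ (1 / 2 : ℝ) * 1 := mul_le_mul h3 h4 (Real.exp_pos _).le (by norm_num)
    _ = 1 / 2 := by norm_num

theorem exp_le_gaussianPDFReal_zero_one {x b : ℝ} (hx : |x| ≤ b) :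
    Real.exp (-b ^ 2 / 2) / 3 ≤ gaussianPDFReal 0 1 x := by
  have h2 : √(2 * Real.pi) ≤ 3 := by
    rw [Real.sqrt_le_left (by norm_num)]; nlinarith [Real.pi_lt_d2]
  have h3 : (1 / 3 : ℝ) ≤ (√(2 * Real.pi))⁻¹ := by
    rw [one_div]; exact inv_anti₀ (by positivity) h2
  have h4 : Real.exp (-b ^ 2 / 2) ≤ Real.exp (-x ^ 2 / 2) := by
    rw [Real.exp_le_exp]; nlinarith [sq_abs x, abs_nonneg x]
  simp only [gaussianPDFReal, NNReal.coe_one, mul_one, sub_zero]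
  calc _ = (1 / 3 : ℝ) * Real.exp (-b ^ 2 / 2) := by ring
    _ ≤ _ := mul_le_mul h3 h4 (Real.exp_pos _).le (by positivity)

theorem gaussianReal_real_eq_integral (s : Set ℝ) :
    (gaussianReal 0 1).real s = ∫ x in s, gaussianPDFReal 0 1 x := by
  rw [Measure.real, gaussianReal_apply_eq_integral _ one_ne_zero,
    ENNReal.toReal_ofReal (integral_nonneg fun _ => gaussianPDFReal_nonneg _ _ _)]

theorem gaussianReal_real_Icc_le {a b : ℝ} (hab : a ≤ b) :
    (gaussianReal 0 1).real (Set.Icc a b) ≤ (b - a) / 2 := by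
  rw [gaussianReal_real_eq_integral]
  calc ∫ x in Set.Icc a b, gaussianPDFReal 0 1 x ≤ ∫ _ in Set.Icc a b, (1 / 2 : ℝ) :=
        setIntegral_mono (integrable_gaussianPDFReal _ _).integrableOn
          (integrableOn_const (by simp)) gaussianPDFReal_zero_one_le
    _ = (b - a) / 2 := by simp [hab]; ring

theorem le_gaussianReal_real_Ico {a b M : ℝ} (hab : a ≤ b) (hM : ∀ x ∈ Set.Ico a b, |x| ≤ M) :
    (b - a) * (Real.exp (-M ^ 2 / 2) / 3) ≤ (gaussianReal 0 1).real (Set.Ico a b) := by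
  rw [gaussianReal_real_eq_integral]
  calc (b - a) * (Real.exp (-M ^ 2 / 2) / 3)
      = ∫ _ in Set.Ico a b, (Real.exp (-M ^ 2 / 2) / 3) := by simp [hab]
    _ ≤ _ := setIntegral_mono_on (integrableOn_const (by simp))
          (integrable_gaussianPDFReal _ _).integrableOn measurableSet_Ico
          fun x hx => exp_le_gaussianPDFReal_zero_one (hM x hx)

theorem gaussianReal_real_neg_preimage {s : Set ℝ} (hs : MeasurableSet s) :
    (gaussianReal 0 1).real ((fun x => -x) ⁻¹' s) = (gaussianReal 0 1).real s := by
  conv_rhs => rw [← neg_zero, ← gaussianReal_map_neg]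
  rw [map_measureReal_apply measurable_neg hs]

theorem gaussianReal_real_Iio_zero : (gaussianReal 0 1).real (Set.Iio 0) = 1 / 2 := by
  have := nullSingletonClass_gaussianReal (μ := 0) (v := 1) one_ne_zero
  have h1 := gaussianReal_real_neg_preimage (measurableSet_Ioi (a := (0 : ℝ)))
  have h2 : (fun x : ℝ => -x) ⁻¹' Set.Ioi 0 = Set.Iio 0 := by ext; simp
  have h3 : (gaussianReal 0 1).real (Set.Ioi 0) = (gaussianReal 0 1).real (Set.Ici 0) :=
    measureReal_congr Ioi_ae_eq_Ici
  have h4 := probReal_add_probReal_compl (μ := gaussianReal 0 1) (measurableSet_Iio (a := (0 : ℝ)))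
  rw [Set.compl_Iio] at h4
  rw [h2] at h1
  linarith

theorem gaussianReal_real_Ici_zero : (gaussianReal 0 1).real (Set.Ici 0) = 1 / 2 := by
  have h4 := probReal_add_probReal_compl (μ := gaussianReal 0 1) (measurableSet_Iio (a := (0 : ℝ)))
  rw [Set.compl_Iio, gaussianReal_real_Iio_zero] at h4
  linarith

theorem gaussianReal_real_Ici_le {a : ℝ} (h0 : 0 ≤ a) (h1 : a ≤ 1) :
    (gaussianReal 0 1).real (Set.Ici a) ≤ 1 / 2 - a / 6 := by
  have h2 : Set.Ici (0 : ℝ) = Set.Ico 0 a ∪ Set.Ici a := (Set.Ico_union_Ici_eq_Ici h0).symm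
  have h3 := gaussianReal_real_Ici_zero
  rw [h2, measureReal_union (Set.disjoint_left.2 fun x hx hx' => not_le.2 hx.2 (Set.mem_Ici.1 hx'))
    measurableSet_Ici] at h3
  have h4 := le_gaussianReal_real_Ico (M := 1) h0 fun x hx => by
    rw [abs_of_nonneg hx.1]; linarith [hx.2]
  -- On [0, 1] the density is thus at least 1/6, the slope in the conclusion.
  have h5 : (1 / 2 : ℝ) ≤ Real.exp (-1 ^ 2 / 2) := by
    have := Real.add_one_le_exp (-1 ^ 2 / 2 : ℝ); linarith
  nlinarith

theorem gaussianReal_real_Iic_neg_le {a : ℝ} (h0 : 0 ≤ a) (h1 : a ≤ 1) :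
    (gaussianReal 0 1).real (Set.Iic (-a)) ≤ 1 / 2 - a / 6 := by
  have h2 : Set.Iic (-a) = (fun x : ℝ => -x) ⁻¹' Set.Ici a := by ext; simp
  rw [h2, gaussianReal_real_neg_preimage measurableSet_Ici]
  exact gaussianReal_real_Ici_le h0 h1

theorem gaussianReal_standardize (m : ℝ) {σ : ℝ} (hσ : 0 < σ) {s : Set ℝ}
    (hs : MeasurableSet s) :
    gaussianReal m (Real.toNNReal (σ ^ 2)) {y | (y - m) / σ ∈ s} = gaussianReal 0 1 s := by
  have h : (gaussianReal m (Real.toNNReal (σ ^ 2))).map (fun y => (y - m) / σ)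
      = gaussianReal 0 1 := by
    have hc : (fun y : ℝ => (y - m) / σ) = (fun y => y / σ) ∘ (fun y => y - m) := rfl
    rw [hc, ← Measure.map_map (by fun_prop) (by fun_prop), gaussianReal_map_sub_const,
      gaussianReal_map_div_const]
    congr 1
    · simp
    · ext
      simp [Real.coe_toNNReal _ (sq_nonneg σ), div_self (pow_pos hσ 2).ne']
  rw [← h, Measure.map_apply (by fun_prop) hs]
  rfl

/-- Gaussian tail lower bound. -/
theorem exp_le_gaussianReal_real_abs_ge {t : ℝ} (ht : 0 ≤ t) :
    Real.exp (-1) / 3 * Real.exp (-t ^ 2) ≤ (gaussianReal 0 1).real {g | t ≤ |g|} := by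
  have h1 := le_gaussianReal_real_Ico (a := t) (b := t + 1) (M := t + 1) (by linarith)
    fun x hx => by rw [abs_of_nonneg (ht.trans hx.1)]; exact hx.2.le
  have h2 : (gaussianReal 0 1).real (Set.Ico t (t + 1))
      ≤ (gaussianReal 0 1).real {g | t ≤ |g|} :=
    measureReal_mono fun x hx => hx.1.trans (le_abs_self x)
  -- This is (t + 1)² / 2 ≤ t² + 1, that is, (t - 1)² ≥ 0.
  have h3 : Real.exp (-1) * Real.exp (-t ^ 2) ≤ Real.exp (-(t + 1) ^ 2 / 2) := by
    rw [← Real.exp_add, Real.exp_le_exp]; nlinarith [sq_nonneg (t - 1)]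
  linarith

end RealGaussian

/-! ### One-dimensional projections of the standard Gaussian vector -/

section StdGaussian

variable {p : ℕ}

theorem stdGaussian_map_inner (v : EuclideanSpace ℝ (Fin p)) :
    (stdGaussian (EuclideanSpace ℝ (Fin p))).map (fun x => inner ℝ v x)
      = gaussianReal 0 (Real.toNNReal (‖v‖ ^ 2)) := by
  have h := IsGaussian.map_eq_gaussianReal (μ := stdGaussian (EuclideanSpace ℝ (Fin p)))
    (innerSL ℝ v)
  rw [integral_strongDual_stdGaussian, variance_dual_stdGaussian, innerSL_apply_norm] at h
  exact h

theorem stdGaussian_map_inner_of_norm_eq_one {v : EuclideanSpace ℝ (Fin p)} (hv : ‖v‖ = 1) :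
    (stdGaussian (EuclideanSpace ℝ (Fin p))).map (fun x => inner ℝ v x) = gaussianReal 0 1 := by
  rw [stdGaussian_map_inner, hv]; simp

theorem stdGaussian_real_inner_mem {v : EuclideanSpace ℝ (Fin p)} (hv : ‖v‖ = 1) {s : Set ℝ}
    (hs : MeasurableSet s) :
    (stdGaussian (EuclideanSpace ℝ (Fin p))).real {x | inner ℝ v x ∈ s}
      = (gaussianReal 0 1).real s := by
  rw [← stdGaussian_map_inner_of_norm_eq_one hv, map_measureReal_apply (by fun_prop) hs]
  rfl

/-- The strip lies over two intervals of length 2w, and the normal density is at most 1/2. -/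
theorem stdGaussian_real_strip_le {v : EuclideanSpace ℝ (Fin p)} (hv : ‖v‖ = 1) (t : ℝ) {w : ℝ}
    (hw : 0 ≤ w) :
    (stdGaussian (EuclideanSpace ℝ (Fin p))).real {x | |(|inner ℝ v x| - t)| ≤ w} ≤ 2 * w := by
  have hsub : {x : EuclideanSpace ℝ (Fin p) | |(|inner ℝ v x| - t)| ≤ w}
      ⊆ {x | inner ℝ v x ∈ Set.Icc (t - w) (t + w) ∪ Set.Icc (-t - w) (-t + w)} := by
    intro x hx
    rw [Set.mem_ofPred_eq, abs_le] at hx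
    obtain ⟨hx1, hx2⟩ := hx
    rcases abs_cases (inner ℝ v x) with h' | h'
    · left; constructor <;> linarith
    · right; constructor <;> linarith
  refine (measureReal_mono hsub).trans ?_
  rw [stdGaussian_real_inner_mem hv (measurableSet_Icc.union measurableSet_Icc)]
  refine (measureReal_union_le _ _).trans ?_
  have h1 := gaussianReal_real_Icc_le (a := t - w) (b := t + w) (by linarith)
  have h2 := gaussianReal_real_Icc_le (a := -t - w) (b := -t + w) (by linarith)
  linarith

/-- Chebyshev's inequality; this weak tail suffices because the nets shrink faster (8^(-k)) than the
strips (4^(-k)). -/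
theorem stdGaussian_real_abs_inner_ge_le (u : EuclideanSpace ℝ (Fin p)) {w : ℝ} (hw : 0 < w) :
    (stdGaussian (EuclideanSpace ℝ (Fin p))).real {x | w ≤ |inner ℝ u x|} ≤ ‖u‖ ^ 2 / w ^ 2 := by
  have hL : MemLp (innerSL ℝ u) 2 (stdGaussian (EuclideanSpace ℝ (Fin p))) :=
    IsGaussian.memLp_dual _ _ _ (by simp)
  have h := meas_ge_le_variance_div_sq hL hw
  rw [integral_strongDual_stdGaussian, variance_dual_stdGaussian, innerSL_apply_norm] at h
  simp only [sub_zero] at h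
  exact ENNReal.toReal_le_of_le_ofReal (by positivity) h

theorem integrable_exp_abs_inner_and_le {u : EuclideanSpace ℝ (Fin p)} (hu : ‖u‖ = 1) :
    Integrable (fun x => Real.exp |inner ℝ u x|) (stdGaussian (EuclideanSpace ℝ (Fin p))) ∧
      ∫ x, Real.exp |inner ℝ u x| ∂(stdGaussian (EuclideanSpace ℝ (Fin p))) ≤ Real.exp 2 := by
  have hi1 := integrable_exp_mul_gaussianReal (μ := 0) (v := 1) 1
  have hi2 := integrable_exp_mul_gaussianReal (μ := 0) (v := 1) (-1)
  have hle : ∀ x : ℝ, Real.exp |x| ≤ Real.exp (1 * x) + Real.exp (-1 * x) := fun x => by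
    rcases abs_cases x with h | h <;> rw [h.1]
    · rw [one_mul]; linarith [Real.exp_pos (-1 * x)]
    · rw [neg_one_mul]; linarith [Real.exp_pos (1 * x)]
  have hi : Integrable (fun x => Real.exp |x|) (gaussianReal 0 1) := by
    refine (hi1.add hi2).mono' (by fun_prop) (.of_forall fun x => ?_)
    rw [Real.norm_of_nonneg (Real.exp_pos _).le]
    exact hle x
  have hm1 : ∫ x, Real.exp (1 * x) ∂(gaussianReal 0 1) = Real.exp (1 / 2) := by
    have := congrFun (mgf_fun_id_gaussianReal (μ := 0) (v := 1)) 1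
    simpa [mgf] using this
  have hm2 : ∫ x, Real.exp (-1 * x) ∂(gaussianReal 0 1) = Real.exp (1 / 2) := by
    have := congrFun (mgf_fun_id_gaussianReal (μ := 0) (v := 1)) (-1)
    simpa [mgf] using this
  have hb : ∫ x, Real.exp |x| ∂(gaussianReal 0 1) ≤ Real.exp 2 := by
    calc _ ≤ ∫ x, (Real.exp (1 * x) + Real.exp (-1 * x)) ∂(gaussianReal 0 1) :=
          integral_mono hi (hi1.add hi2) hle
      _ = 2 * Real.exp (1 / 2) := by rw [integral_add hi1 hi2, hm1, hm2]; ring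
      _ ≤ Real.exp (3 / 2) * Real.exp (1 / 2) := by
          refine mul_le_mul_of_nonneg_right ?_ (Real.exp_pos _).le
          have := Real.add_one_le_exp (3 / 2 : ℝ); linarith
      _ = Real.exp 2 := by rw [← Real.exp_add]; norm_num
  have hmap := stdGaussian_map_inner_of_norm_eq_one hu
  have hmeas : AEMeasurable (fun x => inner ℝ u x) (stdGaussian (EuclideanSpace ℝ (Fin p))) := by
    fun_prop
  constructor
  · rw [← hmap] at hi
    exact hi.comp_aemeasurable hmeas
  · rw [← hmap, integral_map hmeas (by fun_prop)] at hb
    exact hb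

end StdGaussian

/-! ### Signed caps and their dependence on the direction -/

section SignedCap

variable {p : ℕ}

/-- The indicator of the cap `{z | t ≤ s z * vᵀx}`, where `s` is a sign attached to `z = (x, y)`. -/
def capInd (s : EuclideanSpace ℝ (Fin p) × ℝ → ℝ) (t : ℝ) (v : EuclideanSpace ℝ (Fin p)) :
    EuclideanSpace ℝ (Fin p) × ℝ → ℝ :=
  Set.indicator {z | t ≤ s z * inner ℝ v z.1} (fun _ => 1)

/-- The indicator of the double strip `{z | ||vᵀx| - t| ≤ w}`. -/
def stripInd (t w : ℝ) (v : EuclideanSpace ℝ (Fin p)) : EuclideanSpace ℝ (Fin p) × ℝ → ℝ :=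
  Set.indicator {z | |(|inner ℝ v z.1| - t)| ≤ w} (fun _ => 1)

/-- The indicator of `{z | w ≤ |uᵀx|}`. -/
def farInd (w : ℝ) (u : EuclideanSpace ℝ (Fin p)) : EuclideanSpace ℝ (Fin p) × ℝ → ℝ :=
  Set.indicator {z | w ≤ |inner ℝ u z.1|} (fun _ => 1)

theorem abs_indicator_one_le {Z : Type*} (S : Set Z) (z : Z) :
    |S.indicator (fun _ => (1 : ℝ)) z| ≤ 1 := by
  by_cases h : z ∈ S <;> simp [h]

theorem indicator_one_nonneg {Z : Type*} (S : Set Z) (z : Z) :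
    0 ≤ S.indicator (fun _ => (1 : ℝ)) z :=
  Set.indicator_nonneg (fun _ _ => zero_le_one) z

theorem measurableSet_cap {s : EuclideanSpace ℝ (Fin p) × ℝ → ℝ} (hs : Measurable s) (t : ℝ)
    (v : EuclideanSpace ℝ (Fin p)) : MeasurableSet {z | t ≤ s z * inner ℝ v z.1} :=
  measurableSet_le measurable_const (by fun_prop)

theorem measurable_capInd {s : EuclideanSpace ℝ (Fin p) × ℝ → ℝ} (hs : Measurable s) (t : ℝ)
    (v : EuclideanSpace ℝ (Fin p)) : Measurable (capInd s t v) :=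
  measurable_const.indicator (measurableSet_cap hs t v)

theorem measurableSet_strip (t w : ℝ) (v : EuclideanSpace ℝ (Fin p)) :
    MeasurableSet {x : EuclideanSpace ℝ (Fin p) | |(|inner ℝ v x| - t)| ≤ w} :=
  measurableSet_le (by fun_prop) measurable_const

theorem measurableSet_far (w : ℝ) (u : EuclideanSpace ℝ (Fin p)) :
    MeasurableSet {x : EuclideanSpace ℝ (Fin p) | w ≤ |inner ℝ u x|} :=
  measurableSet_le measurable_const (by fun_prop)

theorem measurable_stripInd (t w : ℝ) (v : EuclideanSpace ℝ (Fin p)) :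
    Measurable (stripInd t w v) :=
  measurable_const.indicator (measurable_fst (measurableSet_strip t w v))

theorem measurable_farInd (w : ℝ) (u : EuclideanSpace ℝ (Fin p)) :
    Measurable (farInd w u) :=
  measurable_const.indicator (measurable_fst (measurableSet_far w u))

/-- Two caps differ only on a strip or where the two directions disagree. -/
theorem abs_capInd_sub_le {s : EuclideanSpace ℝ (Fin p) × ℝ → ℝ}
    {z : EuclideanSpace ℝ (Fin p) × ℝ} (hs : s z = -1 ∨ s z = 0 ∨ s z = 1) {t w : ℝ}
    (ht : 0 < t) (a b : EuclideanSpace ℝ (Fin p)) :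
    |capInd s t a z - capInd s t b z| ≤ stripInd t w a z + farInd w (a - b) z := by
  have h0 := indicator_one_nonneg {z | |(|inner ℝ a z.1| - t)| ≤ w} z
  have h1 := indicator_one_nonneg {z | w ≤ |inner ℝ (a - b) z.1|} z
  change |Set.indicator _ _ z - Set.indicator _ _ z| ≤ Set.indicator _ _ z + Set.indicator _ _ z
  by_cases hS : z ∈ {z : EuclideanSpace ℝ (Fin p) × ℝ | |(|inner ℝ a z.1| - t)| ≤ w}
  · rw [Set.indicator_of_mem hS]
    have ha := abs_indicator_one_le {z | t ≤ s z * inner ℝ a z.1} z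
    have hb := abs_indicator_one_le {z | t ≤ s z * inner ℝ b z.1} z
    have ha' := indicator_one_nonneg {z | t ≤ s z * inner ℝ a z.1} z
    have hb' := indicator_one_nonneg {z | t ≤ s z * inner ℝ b z.1} z
    rw [abs_of_nonneg ha'] at ha
    rw [abs_of_nonneg hb'] at hb
    rw [abs_le]
    constructor <;> linarith
  by_cases hF : z ∈ {z : EuclideanSpace ℝ (Fin p) × ℝ | w ≤ |inner ℝ (a - b) z.1|}
  · rw [Set.indicator_of_mem hF]
    have ha := abs_indicator_one_le {z | t ≤ s z * inner ℝ a z.1} z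
    have hb := abs_indicator_one_le {z | t ≤ s z * inner ℝ b z.1} z
    have ha' := indicator_one_nonneg {z | t ≤ s z * inner ℝ a z.1} z
    have hb' := indicator_one_nonneg {z | t ≤ s z * inner ℝ b z.1} z
    rw [abs_of_nonneg ha'] at ha
    rw [abs_of_nonneg hb'] at hb
    rw [abs_le]
    constructor <;> linarith
  -- Here the two inner products differ by less than w. If only one cap contained z, the threshold t
  -- would separate their signed values, putting |aᵀx| within w of t, against `hS`.
  have hiff : t ≤ s z * inner ℝ a z.1 ↔ t ≤ s z * inner ℝ b z.1 := by
    rw [Set.mem_ofPred_eq, not_le] at hS hF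
    rw [inner_sub_left, abs_lt] at hF
    obtain ⟨hF1, hF2⟩ := hF
    by_contra hne
    refine absurd hS (not_lt.2 (abs_le.2 ?_))
    rcases hs with h | h | h <;> rw [h] at hne <;>
      rcases abs_cases (inner ℝ a z.1) with h' | h' <;>
      by_cases h2 : t ≤ s z * inner ℝ a z.1 <;> rw [h] at h2 <;>
      by_cases h3 : t ≤ s z * inner ℝ b z.1 <;> rw [h] at h3 <;>
      first
        | exact absurd (iff_of_true h2 h3) hne
        | exact absurd (iff_of_false h2 h3) hne
        | (constructor <;> linarith)
  have : Set.indicator {z | t ≤ s z * inner ℝ a z.1} (fun _ => (1 : ℝ)) z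
      = Set.indicator {z | t ≤ s z * inner ℝ b z.1} (fun _ => (1 : ℝ)) z := by
    by_cases h : t ≤ s z * inner ℝ a z.1
    · rw [Set.indicator_of_mem (by exact h), Set.indicator_of_mem (by exact hiff.1 h)]
    · rw [Set.indicator_of_notMem (by exact h), Set.indicator_of_notMem (by exact mt hiff.2 h)]
  rw [this, sub_self, abs_zero]
  exact add_nonneg h0 h1

variable {ν : Measure (EuclideanSpace ℝ (Fin p) × ℝ)}

theorem integral_abs_indicator_one {Z : Type*} [MeasurableSpace Z] {ν : Measure Z} {S : Set Z}
    (hS : MeasurableSet S) : ∫ z, |S.indicator (fun _ => (1 : ℝ)) z| ∂ν = ν.real S := by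
  simp_rw [abs_of_nonneg (indicator_one_nonneg S _)]
  exact integral_indicator_one hS

theorem integral_stripInd_le (hν : ν.map Prod.fst = stdGaussian (EuclideanSpace ℝ (Fin p)))
    {v : EuclideanSpace ℝ (Fin p)} (hv : ‖v‖ = 1) (t : ℝ) {w : ℝ} (hw : 0 ≤ w) :
    ∫ z, |stripInd t w v z| ∂ν ≤ 2 * w := by
  have h := stdGaussian_real_strip_le hv t hw
  rw [← hν, map_measureReal_apply measurable_fst (measurableSet_strip t w v)] at h
  exact (integral_abs_indicator_one (measurable_fst (measurableSet_strip t w v))).trans_le h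

theorem integral_farInd_le (hν : ν.map Prod.fst = stdGaussian (EuclideanSpace ℝ (Fin p)))
    (u : EuclideanSpace ℝ (Fin p)) {w : ℝ} (hw : 0 < w) :
    ∫ z, |farInd w u z| ∂ν ≤ ‖u‖ ^ 2 / w ^ 2 := by
  have h := stdGaussian_real_abs_inner_ge_le u hw
  rw [← hν, map_measureReal_apply measurable_fst (measurableSet_far w u)] at h
  exact (integral_abs_indicator_one (measurable_fst (measurableSet_far w u))).trans_le h

theorem integrable_of_abs_le_one {Z : Type*} [MeasurableSpace Z] {ν : Measure Z}
    [IsFiniteMeasure ν] {h : Z → ℝ} (hm : Measurable h) (h1 : ∀ z, |h z| ≤ 1) : Integrable h ν :=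
  Integrable.of_bound hm.aestronglyMeasurable 1 (.of_forall h1)

theorem abs_capInd_sub_le_one (s : EuclideanSpace ℝ (Fin p) × ℝ → ℝ) (t : ℝ)
    (a b : EuclideanSpace ℝ (Fin p)) (z : EuclideanSpace ℝ (Fin p) × ℝ) :
    |capInd s t a z - capInd s t b z| ≤ 1 := by
  have ha := abs_indicator_one_le {z | t ≤ s z * inner ℝ a z.1} z
  have hb := abs_indicator_one_le {z | t ≤ s z * inner ℝ b z.1} z
  have ha' := indicator_one_nonneg {z | t ≤ s z * inner ℝ a z.1} z
  have hb' := indicator_one_nonneg {z | t ≤ s z * inner ℝ b z.1} z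
  rw [abs_of_nonneg ha'] at ha
  rw [abs_of_nonneg hb'] at hb
  change |Set.indicator _ _ z - Set.indicator _ _ z| ≤ 1
  rw [abs_le]
  constructor <;> linarith

theorem integral_abs_capInd_sub_le [IsProbabilityMeasure ν]
    (hν : ν.map Prod.fst = stdGaussian (EuclideanSpace ℝ (Fin p)))
    {s : EuclideanSpace ℝ (Fin p) × ℝ → ℝ} (hsm : Measurable s)
    (hs : ∀ z, s z = -1 ∨ s z = 0 ∨ s z = 1) {t w : ℝ} (ht : 0 < t) (hw : 0 < w)
    {a : EuclideanSpace ℝ (Fin p)} (ha : ‖a‖ = 1) (b : EuclideanSpace ℝ (Fin p)) :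
    ∫ z, |capInd s t a z - capInd s t b z| ∂ν ≤ 2 * w + ‖a - b‖ ^ 2 / w ^ 2 := by
  have i1 : Integrable (fun z => |stripInd t w a z|) ν :=
    (integrable_of_abs_le_one (measurable_stripInd t w a) (abs_indicator_one_le _)).abs
  have i2 : Integrable (fun z => |farInd w (a - b) z|) ν :=
    (integrable_of_abs_le_one (measurable_farInd w (a - b)) (abs_indicator_one_le _)).abs
  calc ∫ z, |capInd s t a z - capInd s t b z| ∂ν
      ≤ ∫ z, (|stripInd t w a z| + |farInd w (a - b) z|) ∂ν := by
        refine integral_mono ?_ (i1.add i2) fun z => ?_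
        · exact (integrable_of_abs_le_one
            ((measurable_capInd hsm t a).sub (measurable_capInd hsm t b))
            (abs_capInd_sub_le_one s t a b)).abs
        · exact (abs_capInd_sub_le (hs z) ht a b).trans
            (add_le_add (le_abs_self _) (le_abs_self _))
    _ ≤ _ := by
        rw [integral_add i1 i2]
        exact add_le_add (integral_stripInd_le hν ha t hw.le) (integral_farInd_le hν _ hw)

theorem empMean_mono {n : ℕ} {Z : Type*} (z : Fin n → Z) {g h : Z → ℝ}
    (hgh : ∀ i, g (z i) ≤ h (z i)) : empMean z g ≤ empMean z h :=
  mul_le_mul_of_nonneg_left (Finset.sum_le_sum fun i _ => hgh i) (by positivity)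

/-- Closes the chain, where `b` is an arbitrary unit vector outside every finite family. The far
indicator is therefore replaced by its Markov bound, a seminorm of a - b that a net controls
uniformly. -/
theorem abs_empMean_capInd_sub_le {n : ℕ} (z : Fin n → EuclideanSpace ℝ (Fin p) × ℝ)
    {s : EuclideanSpace ℝ (Fin p) × ℝ → ℝ}
    (hs : ∀ z, s z = -1 ∨ s z = 0 ∨ s z = 1) {t w : ℝ} (ht : 0 < t) (hw : 0 < w)
    (a b : EuclideanSpace ℝ (Fin p)) :
    |empMean z (capInd s t a) - empMean z (capInd s t b)|
      ≤ empMean z (stripInd t w a) + w⁻¹ * empMean z (fun y => |inner ℝ (a - b) y.1|) := by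
  have hfar : ∀ y, farInd w (a - b) y ≤ w⁻¹ * |inner ℝ (a - b) y.1| := by
    intro y
    by_cases h : w ≤ |inner ℝ (a - b) y.1|
    · have h1 : farInd w (a - b) y = 1 := Set.indicator_of_mem (by exact h) _
      rw [h1, inv_mul_eq_div, one_le_div hw]
      exact h
    · have h1 : farInd w (a - b) y = 0 := Set.indicator_of_notMem (by exact h) _
      rw [h1]
      positivity
  have hsum : |∑ i, (capInd s t a (z i) - capInd s t b (z i))|
      ≤ ∑ i, (stripInd t w a (z i) + w⁻¹ * |inner ℝ (a - b) (z i).1|) :=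
    (Finset.abs_sum_le_sum_abs _ _).trans (Finset.sum_le_sum fun i _ =>
      (abs_capInd_sub_le (hs _) ht a b).trans (by gcongr; exact hfar _))
  have e1 : empMean z (capInd s t a) - empMean z (capInd s t b)
      = (1 / (n : ℝ)) * ∑ i, (capInd s t a (z i) - capInd s t b (z i)) := by
    rw [Finset.sum_sub_distrib, mul_sub]; rfl
  have e2 : empMean z (stripInd t w a) + w⁻¹ * empMean z (fun y => |inner ℝ (a - b) y.1|)
      = (1 / (n : ℝ)) * ∑ i, (stripInd t w a (z i) + w⁻¹ * |inner ℝ (a - b) (z i).1|) := by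
    rw [Finset.sum_add_distrib, mul_add, ← Finset.mul_sum]
    simp only [empMean]
    ring
  rw [e1, e2, abs_mul, abs_of_nonneg (by positivity)]
  gcongr

/-- A bound of `∑ |uᵀ xᵢ|` on a `1 / 2`-net of the sphere extends to all directions. -/
theorem sum_abs_inner_le_of_net {ι : Type*} [Fintype ι] (x : ι → EuclideanSpace ℝ (Fin p))
    {N : Finset (EuclideanSpace ℝ (Fin p))} {A : ℝ}
    (hN : ∀ v : EuclideanSpace ℝ (Fin p), ‖v‖ = 1 → ∃ a ∈ N, ‖v - a‖ ≤ 1 / 2)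
    (hA : ∀ a ∈ N, ∑ i, |inner ℝ a (x i)| ≤ A) (u : EuclideanSpace ℝ (Fin p)) :
    ∑ i, |inner ℝ u (x i)| ≤ 2 * A * ‖u‖ := by
  rcases eq_or_ne u 0 with rfl | hu
  · simp
  have hscale : ∀ u : EuclideanSpace ℝ (Fin p), u ≠ 0 →
      ‖(‖u‖⁻¹ • u)‖ = 1 ∧
      ∑ i, |inner ℝ u (x i)| = ‖u‖ * ∑ i, |inner ℝ (‖u‖⁻¹ • u) (x i)| := by
    intro u hu
    have hpos : 0 < ‖u‖ := norm_pos_iff.2 hu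
    refine ⟨by rw [norm_smul, norm_inv, norm_norm, inv_mul_cancel₀ hpos.ne'], ?_⟩
    rw [Finset.mul_sum]
    refine Finset.sum_congr rfl fun i _ => ?_
    rw [inner_smul_left, abs_mul]
    simp only [RCLike.conj_to_real, abs_inv, abs_norm]
    rw [mul_inv_cancel_left₀ hpos.ne']
  -- With m the maximum over the sphere, a net point near the maximizer gives m ≤ A + m / 2, so m ≤
  -- 2A.
  obtain ⟨v, hv, hmax⟩ := (isCompact_sphere (0 : EuclideanSpace ℝ (Fin p)) 1).exists_isMaxOn
    ⟨_, mem_sphere_zero_iff_norm.2 (hscale u hu).1⟩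
    (f := fun v => ∑ i, |inner ℝ v (x i)|) (by fun_prop)
  rw [mem_sphere_zero_iff_norm] at hv
  have hle : ∀ u : EuclideanSpace ℝ (Fin p),
      ∑ i, |inner ℝ u (x i)| ≤ ‖u‖ * ∑ i, |inner ℝ v (x i)| := by
    intro u
    rcases eq_or_ne u 0 with rfl | hu
    · simp
    · rw [(hscale u hu).2]
      exact mul_le_mul_of_nonneg_left
        (hmax (mem_sphere_zero_iff_norm.2 (hscale u hu).1)) (norm_nonneg _)
  obtain ⟨a, ha, hva⟩ := hN v hv
  have h1 : ∑ i, |inner ℝ v (x i)| ≤ ∑ i, |inner ℝ a (x i)| + ∑ i, |inner ℝ (v - a) (x i)| := by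
    rw [← Finset.sum_add_distrib]
    refine Finset.sum_le_sum fun i _ => ?_
    rw [inner_sub_left]
    calc |inner ℝ v (x i)| = |inner ℝ a (x i) + (inner ℝ v (x i) - inner ℝ a (x i))| := by
          congr 1; ring
      _ ≤ _ := abs_add_le _ _
  have h0 : 0 ≤ ∑ i, |inner ℝ v (x i)| := Finset.sum_nonneg fun _ _ => abs_nonneg _
  have h2 := hle (v - a)
  have h3 := hA a ha
  have h4 : ∑ i, |inner ℝ v (x i)| ≤ 2 * A := by nlinarith
  calc _ ≤ ‖u‖ * ∑ i, |inner ℝ v (x i)| := hle u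
    _ ≤ ‖u‖ * (2 * A) := mul_le_mul_of_nonneg_left h4 (norm_nonneg _)
    _ = _ := by ring

end SignedCap

/-! ### Chaining over the sphere -/

section UniformDeviation

variable {n p : ℕ} {Ω : Type*} [MeasurableSpace Ω] {μ : Measure Ω} [IsProbabilityMeasure μ]
  {ν : Measure (EuclideanSpace ℝ (Fin p) × ℝ)} {W : Fin n → Ω → EuclideanSpace ℝ (Fin p) × ℝ}
  {s : EuclideanSpace ℝ (Fin p) × ℝ → ℝ} {t B : ℝ}

theorem five_pow_le_exp {N m : ℕ} (h : N ≤ 5 ^ m) : (N : ℝ) ≤ Real.exp (2 * m) := by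
  have h5 : (5 : ℝ) ≤ Real.exp 2 := by
    have h1 := Real.exp_one_gt_d9
    have h2 : Real.exp 2 = Real.exp 1 * Real.exp 1 := by rw [← Real.exp_add]; norm_num
    rw [h2]; nlinarith
  calc (N : ℝ) ≤ (5 : ℝ) ^ m := by exact_mod_cast h
    _ ≤ Real.exp 2 ^ m := pow_le_pow_left₀ (by norm_num) h5 m
    _ = Real.exp (2 * m) := by rw [← Real.exp_nat_mul]; ring_nf

instance decidableEqTestFunction : DecidableEq (EuclideanSpace ℝ (Fin p) × ℝ → ℝ) :=
  Classical.decEq _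

/-- The functions controlled at one level of the chain: increments between two consecutive nets,
and strips around the directions of the coarser one. -/
def chainFamily (s : EuclideanSpace ℝ (Fin p) × ℝ → ℝ) (t : ℝ)
    (N N' : Finset (EuclideanSpace ℝ (Fin p))) (k : ℕ) :
    Finset (EuclideanSpace ℝ (Fin p) × ℝ → ℝ) :=
  ((N ×ˢ N').filter fun ab => ‖ab.1 - ab.2‖ ≤ 2 * ((1 / 2) ^ k) ^ 3).image
    (fun ab z => capInd s t ab.1 z - capInd s t ab.2 z) ∪
    N.image (fun a => stripInd t (((1 / 2) ^ k) ^ 2) a)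

theorem card_chainFamily_le {N N' : Finset (EuclideanSpace ℝ (Fin p))} {k : ℕ}
    (hN : N.card ≤ 5 ^ (p * (3 * k + 1))) (hN' : N'.card ≤ 5 ^ (p * (3 * (k + 1) + 1)))
    (hp : 0 < p) : (chainFamily s t N N' k).card ≤ 5 ^ (p * (6 * k + 6)) := by
  have h1 : (chainFamily s t N N' k).card ≤ N.card * N'.card + N.card := by
    refine (Finset.card_union_le _ _).trans (add_le_add ?_ Finset.card_image_le)
    exact Finset.card_image_le.trans ((Finset.card_filter_le _ _).trans
      (Finset.card_product _ _).le)
  have h2 : N.card * N'.card ≤ 5 ^ (p * (6 * k + 5)) := by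
    refine (Nat.mul_le_mul hN hN').trans_eq ?_
    rw [← pow_add]
    congr 1
    ring
  have h3 : N.card ≤ 5 ^ (p * (6 * k + 5)) :=
    hN.trans (Nat.pow_le_pow_right (by norm_num) (Nat.mul_le_mul_left _ (by omega)))
  have h4 : 5 ^ (p * (6 * k + 5)) * 5 ≤ 5 ^ (p * (6 * k + 6)) := by
    rw [← pow_succ]
    exact Nat.pow_le_pow_right (by norm_num) (by nlinarith)
  omega

/-- Probability that some increment at level `k` of the chain deviates too much. -/
theorem measure_chainFamily_le (hn : 0 < n) (hp : 0 < p) (hW : ∀ i, HasLaw (W i) ν μ)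
    (hind : iIndepFun W μ) (hν : ν.map Prod.fst = stdGaussian (EuclideanSpace ℝ (Fin p)))
    (hsm : Measurable s) (hs : ∀ z, s z = -1 ∨ s z = 0 ∨ s z = 1) (ht : 0 < t) (hB : 0 ≤ B)
    {N N' : Finset (EuclideanSpace ℝ (Fin p))} {k : ℕ}
    (hN : N.card ≤ 5 ^ (p * (3 * k + 1))) (hN' : N'.card ≤ 5 ^ (p * (3 * (k + 1) + 1)))
    (hunit : ∀ a ∈ N, ‖a‖ = 1) (hk : √((p : ℝ) / n) ≤ (1 / 2) ^ k) :
    μ {ω | ∃ h ∈ chainFamily s t N N' k, √((p : ℝ) / n) * ((13 * k + 18 + B) * (1 / 2) ^ k)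
        < |empMean (fun i => W i ω) h - ∫ z, h z ∂ν|}
      ≤ ENNReal.ofReal (2 * Real.exp (-B) * (1 / 2) ^ k) := by
  have hprob : IsProbabilityMeasure ν := (hW ⟨0, hn⟩).isProbabilityMeasure_iff.1 inferInstance
  have hn' : (0 : ℝ) < n := by exact_mod_cast hn
  have hp' : (1 : ℝ) ≤ p := by exact_mod_cast hp
  have hcard := five_pow_le_exp (card_chainFamily_le (s := s) (t := t) hN hN' hp)
  push_cast at hcard
  set x : ℝ := (1 / 2) ^ k with hx
  set r : ℝ := √((p : ℝ) / n) with hr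
  have hx0 : 0 < x := by positivity
  have hr0 : 0 < r := Real.sqrt_pos.2 (by positivity)
  have hr2 : r ^ 2 = p / n := Real.sq_sqrt (by positivity)
  -- τ = 6x² is 2w from the strip, with w = x², plus 4x² from Chebyshev at distance 2x³. Taking `l =
  -- r / x` makes both Bernstein terms of order r x. The family has at most exp(p(12k + 12))
  -- members, so this L leaves exp(-p(k + B)).
  have key := measure_exists_abs_empMean_sub_gt_le (τ := 6 * x ^ 2) (l := r / x)
    (L := p * (13 * k + 12 + B)) hn hW hind (chainFamily s t N N' k) ?_ (by positivity)
    ((div_le_one hx0).2 hk)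
  · have hthr : r / x * (6 * x ^ 2) + p * (13 * k + 12 + B) / (n * (r / x))
        = r * ((13 * k + 18 + B) * x) := by
      have : (p : ℝ) = r ^ 2 * n := by rw [hr2]; field_simp
      rw [this]
      field_simp
      ring
    rw [hthr] at key
    refine key.trans (ENNReal.ofReal_le_ofReal ?_)
    have hxk : Real.exp (-k) ≤ x := by
      have h1 : Real.exp (-1) ≤ 1 / 2 := by
        rw [Real.exp_neg, one_div]
        exact inv_anti₀ (by norm_num) (by linarith [Real.exp_one_gt_d9])
      calc Real.exp (-k) = Real.exp (-1) ^ k := by rw [← Real.exp_nat_mul]; ring_nf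
        _ ≤ x := pow_le_pow_left₀ (Real.exp_pos _).le h1 k
    calc ((chainFamily s t N N' k).card : ℝ) * (2 * Real.exp (-(p * (13 * k + 12 + B))))
        ≤ Real.exp (2 * (p * (6 * k + 6))) * (2 * Real.exp (-(p * (13 * k + 12 + B)))) :=
          mul_le_mul_of_nonneg_right hcard (by positivity)
      _ = 2 * Real.exp (-(p * (k + B))) := by
          rw [mul_left_comm, ← Real.exp_add]; ring_nf
      _ ≤ 2 * Real.exp (-B + -k) := by
          gcongr
          have hk0 : (0 : ℝ) ≤ k := Nat.cast_nonneg k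
          nlinarith
      _ = 2 * Real.exp (-B) * Real.exp (-k) := by rw [Real.exp_add]; ring
      _ ≤ 2 * Real.exp (-B) * x := by gcongr
  · intro h hh
    rcases Finset.mem_union.1 hh with hh | hh
    · obtain ⟨⟨a, b⟩, hab, rfl⟩ := Finset.mem_image.1 hh
      obtain ⟨hab, hdist⟩ := Finset.mem_filter.1 hab
      refine ⟨(measurable_capInd hsm t a).sub (measurable_capInd hsm t b),
        abs_capInd_sub_le_one s t a b, ?_⟩
      refine (integral_abs_capInd_sub_le hν hsm hs ht (pow_pos hx0 2)
        (hunit a (Finset.mem_product.1 hab).1) b).trans ?_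
      have h1 : ‖a - b‖ ^ 2 / (x ^ 2) ^ 2 ≤ (2 * x ^ 3) ^ 2 / (x ^ 2) ^ 2 := by
        gcongr
      have h2 : (2 * x ^ 3) ^ 2 / (x ^ 2) ^ 2 = 4 * x ^ 2 := by field_simp; norm_num
      linarith
    · obtain ⟨a, ha, rfl⟩ := Finset.mem_image.1 hh
      refine ⟨measurable_stripInd t _ a, abs_indicator_one_le _, ?_⟩
      refine (integral_stripInd_le hν (hunit a ha) t (by positivity)).trans ?_
      nlinarith [sq_nonneg x]

/-- The start of the chain: the caps on the coarsest net, where the trivial bound τ = 1 suffices. -/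
theorem measure_capInd_net_le (hn : 0 < n) (hp : 0 < p) (hpn : p ≤ n)
    (hW : ∀ i, HasLaw (W i) ν μ) (hind : iIndepFun W μ) (hsm : Measurable s) (hB : 0 ≤ B)
    {N : Finset (EuclideanSpace ℝ (Fin p))} (hN : N.card ≤ 5 ^ (p * (3 * 0 + 1))) :
    μ {ω | ∃ a ∈ N, √((p : ℝ) / n) * (13 + B)
        < |empMean (fun i => W i ω) (capInd s t a) - ∫ z, capInd s t a z ∂ν|}
      ≤ ENNReal.ofReal (2 * Real.exp (-B)) := by
  have hprob : IsProbabilityMeasure ν := (hW ⟨0, hn⟩).isProbabilityMeasure_iff.1 inferInstance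
  have hn' : (0 : ℝ) < n := by exact_mod_cast hn
  have hp' : (1 : ℝ) ≤ p := by exact_mod_cast hp
  have hcard := five_pow_le_exp hN
  norm_num at hcard
  set r : ℝ := √((p : ℝ) / n) with hr
  have hr0 : 0 < r := Real.sqrt_pos.2 (by positivity)
  have hr1 : r ≤ 1 := Real.sqrt_le_one.2 ((div_le_one hn').2 (by exact_mod_cast hpn))
  have hr2 : r ^ 2 = p / n := Real.sq_sqrt (by positivity)
  have key := measure_exists_abs_empMean_sub_gt_le (τ := 1) (l := r)
    (L := p * (12 + B)) hn hW hind (N.image fun a => capInd s t a) ?_ hr0 hr1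
  · have hthr : r * 1 + p * (12 + B) / (n * r) = r * (13 + B) := by
      have : (p : ℝ) = r ^ 2 * n := by rw [hr2]; field_simp
      rw [this]
      field_simp
      ring
    rw [hthr] at key
    refine (measure_mono ?_).trans (key.trans (ENNReal.ofReal_le_ofReal ?_))
    · rintro ω ⟨a, ha, hω⟩
      exact ⟨_, Finset.mem_image_of_mem _ ha, hω⟩
    · have hc : ((N.image fun a => capInd s t a).card : ℝ) ≤ N.card := by
        exact_mod_cast Finset.card_image_le
      calc ((N.image fun a => capInd s t a).card : ℝ) * (2 * Real.exp (-(p * (12 + B))))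
          ≤ Real.exp (2 * p) * (2 * Real.exp (-(p * (12 + B)))) :=
            mul_le_mul_of_nonneg_right (hc.trans hcard) (by positivity)
        _ = 2 * Real.exp (-(p * (10 + B))) := by
            rw [mul_left_comm, ← Real.exp_add]; ring_nf
        _ ≤ 2 * Real.exp (-B) := by
            gcongr
            nlinarith
  · intro h hh
    obtain ⟨a, ha, rfl⟩ := Finset.mem_image.1 hh
    refine ⟨measurable_capInd hsm t a, abs_indicator_one_le _, ?_⟩
    exact (integral_abs_indicator_one (measurableSet_cap hsm t a)).trans_le measureReal_le_one

/-- The net has at most exp(4p) ≤ exp(4n) points and each exponential moment is at most exp 2, so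
the threshold (6 + B)n leaves exp(-Bn). -/
theorem measure_sum_abs_inner_net_le (hn : 0 < n) (hpn : p ≤ n) (hW : ∀ i, HasLaw (W i) ν μ)
    (hind : iIndepFun W μ) (hν : ν.map Prod.fst = stdGaussian (EuclideanSpace ℝ (Fin p)))
    (hB : 0 ≤ B) {N : Finset (EuclideanSpace ℝ (Fin p))} (hN : N.card ≤ 5 ^ (p * (1 + 1)))
    (hunit : ∀ a ∈ N, ‖a‖ = 1) :
    μ {ω | ∃ a ∈ N, (6 + B) * n < ∑ i, |inner ℝ a (W i ω).1|} ≤ ENNReal.ofReal (Real.exp (-B)) := by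
  have hn' : (1 : ℝ) ≤ n := by exact_mod_cast hn
  have hpn' : (p : ℝ) ≤ n := by exact_mod_cast hpn
  have hcard := five_pow_le_exp hN
  push_cast at hcard
  have hset : {ω | ∃ a ∈ N, (6 + B) * n < ∑ i, |inner ℝ a (W i ω).1|}
      ⊆ ⋃ a ∈ N, {ω | (6 + B) * n ≤ ∑ i, |inner ℝ a (W i ω).1|} := by
    rintro ω ⟨a, ha, hω⟩
    exact Set.mem_biUnion ha hω.le
  have hone : ∀ a ∈ N, μ {ω | (6 + B) * n ≤ ∑ i, |inner ℝ a (W i ω).1|}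
      ≤ ENNReal.ofReal (Real.exp (-1 * ((6 + B) * n) + n * 2)) := by
    intro a ha
    obtain ⟨hi, hle⟩ := integrable_exp_abs_inner_and_le (hunit a ha)
    rw [← hν] at hi
    rw [← hν, integral_map (by fun_prop) (by fun_prop)] at hle
    refine measure_sum_ge_le hW hind (h := fun z => |inner ℝ a z.1|) (by fun_prop) zero_le_one
      ?_ _ ?_
    · simp only [one_mul]
      exact hi.comp_aemeasurable (by fun_prop)
    · simpa only [one_mul] using hle
  refine (measure_mono hset).trans ((measure_biUnion_finset_le _ _).trans
    ((Finset.sum_le_sum hone).trans ?_))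
  rw [Finset.sum_const, nsmul_eq_mul, ← ENNReal.ofReal_natCast, ← ENNReal.ofReal_mul (by positivity)]
  refine ENNReal.ofReal_le_ofReal ?_
  calc (N.card : ℝ) * Real.exp (-1 * ((6 + B) * n) + n * 2)
      ≤ Real.exp (2 * (p * 2)) * Real.exp (-1 * ((6 + B) * n) + n * 2) :=
        mul_le_mul_of_nonneg_right hcard (Real.exp_pos _).le
    _ ≤ Real.exp (-B) := by
        rw [← Real.exp_add, Real.exp_le_exp]
        nlinarith

/-- Only the bound 62 + 2B, independent of K, matters; the closed form makes the induction work. -/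
theorem sum_chain_error (B : ℝ) (K : ℕ) :
    ∑ k ∈ Finset.range K, ((13 * k + 18 + B) * (1 / 2 : ℝ) ^ k)
      = 62 + 2 * B - (26 * K + 62 + 2 * B) * (1 / 2) ^ K := by
  induction K with
  | zero => simp
  | succ K ih => rw [Finset.sum_range_succ, ih]; push_cast; ring

/-- The deterministic part of the chaining argument. -/
theorem abs_empMean_capInd_sub_le_of_chain [IsProbabilityMeasure ν] (hn : 0 < n)
    (hν : ν.map Prod.fst = stdGaussian (EuclideanSpace ℝ (Fin p)))
    (hsm : Measurable s) (hs : ∀ z, s z = -1 ∨ s z = 0 ∨ s z = 1) (ht : 0 < t) (hB : 0 ≤ B)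
    (z : Fin n → EuclideanSpace ℝ (Fin p) × ℝ) {N : ℕ → Finset (EuclideanSpace ℝ (Fin p))}
    {M : Finset (EuclideanSpace ℝ (Fin p))} {K : ℕ} {r : ℝ} (hr : 0 ≤ r)
    (hK : (1 / 2) ^ K ≤ 2 * r)
    (hunit : ∀ k, ∀ a ∈ N k, ‖a‖ = 1)
    (hcov : ∀ k, ∀ v : EuclideanSpace ℝ (Fin p), ‖v‖ = 1 → ∃ a ∈ N k, ‖v - a‖ ≤ ((1 / 2) ^ k) ^ 3)
    (hM : ∀ v : EuclideanSpace ℝ (Fin p), ‖v‖ = 1 → ∃ a ∈ M, ‖v - a‖ ≤ 1 / 2)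
    (hbase : ∀ a ∈ N 0, |empMean z (capInd s t a) - ∫ z, capInd s t a z ∂ν| ≤ r * (13 + B))
    (hlevel : ∀ k ≤ K, ∀ h ∈ chainFamily s t (N k) (N (k + 1)) k,
      |empMean z h - ∫ z, h z ∂ν| ≤ r * ((13 * k + 18 + B) * (1 / 2) ^ k))
    (hnet : ∀ a ∈ M, ∑ i, |inner ℝ a (z i).1| ≤ (6 + B) * n)
    {v : EuclideanSpace ℝ (Fin p)} (hv : ‖v‖ = 1) :
    |empMean z (capInd s t v) - ∫ z, capInd s t v z ∂ν| ≤ (140 + 8 * B) * r := by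
  have hn' : (0 : ℝ) < n := by exact_mod_cast hn
  choose π hπ hvπ using fun k => hcov k v hv
  have hint : ∀ a, Integrable (capInd s t a) ν := fun a =>
    integrable_of_abs_le_one (measurable_capInd hsm t a) (abs_indicator_one_le _)
  have hchain : ∀ m ≤ K, |empMean z (capInd s t (π m)) - ∫ z, capInd s t (π m) z ∂ν|
      ≤ r * (13 + B) + ∑ k ∈ Finset.range m, r * ((13 * k + 18 + B) * (1 / 2) ^ k) := by
    intro m
    induction m with
    | zero => intro _; simpa using hbase _ (hπ 0)
    | succ m ih =>
      intro hm
      have h1 := ih (by omega)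
      have hmem : (fun z => capInd s t (π m) z - capInd s t (π (m + 1)) z)
          ∈ chainFamily s t (N m) (N (m + 1)) m := by
        refine Finset.mem_union_left _ (Finset.mem_image.2 ⟨(π m, π (m + 1)), ?_, rfl⟩)
        refine Finset.mem_filter.2 ⟨Finset.mem_product.2 ⟨hπ m, hπ (m + 1)⟩, ?_⟩
        have h2 := hvπ m
        have h3 := hvπ (m + 1)
        have h4 : ((1 / 2 : ℝ) ^ (m + 1)) ^ 3 ≤ ((1 / 2 : ℝ) ^ m) ^ 3 := by
          gcongr ?_ ^ 3
          exact pow_le_pow_of_le_one (by norm_num) (by norm_num) (by omega)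
        calc ‖π m - π (m + 1)‖ = ‖(v - π (m + 1)) - (v - π m)‖ := by congr 1; abel
          _ ≤ ‖v - π (m + 1)‖ + ‖v - π m‖ := norm_sub_le _ _
          _ ≤ 2 * ((1 / 2) ^ m) ^ 3 := by linarith
      have h2 := hlevel m (by omega) _ hmem
      rw [integral_sub (hint _) (hint _)] at h2
      have h3 : empMean z (fun z => capInd s t (π m) z - capInd s t (π (m + 1)) z)
          = empMean z (capInd s t (π m)) - empMean z (capInd s t (π (m + 1))) := by
        simp only [empMean, Finset.sum_sub_distrib, mul_sub]
      rw [h3] at h2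
      rw [Finset.sum_range_succ]
      rw [abs_le] at h1 h2 ⊢
      constructor <;> linarith [h1.1, h1.2, h2.1, h2.2]
  have hend := hchain K le_rfl
  rw [← Finset.mul_sum, sum_chain_error] at hend
  set x : ℝ := (1 / 2) ^ K with hx
  have hx0 : 0 < x := by positivity
  have hx1 : x ≤ 1 := pow_le_one₀ (by norm_num) (by norm_num)
  have hKx : K * x ≤ 1 := by
    have h1 : (K : ℝ) ≤ 2 ^ K := by exact_mod_cast Nat.lt_two_pow_self.le
    calc K * x ≤ 2 ^ K * x := by gcongr
      _ = 1 := by rw [hx, ← mul_pow]; norm_num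
  -- The remainder from the last net to v uses w = x²: the deterministic terms are O(x²), the far
  -- term is O(x³ / x²), and x ≤ 2r.
  have hemp := abs_empMean_capInd_sub_le z hs (t := t) ht (pow_pos hx0 2) (π K) v
  have hpop : |∫ z, capInd s t (π K) z ∂ν - ∫ z, capInd s t v z ∂ν|
      ≤ 2 * x ^ 2 + ‖π K - v‖ ^ 2 / (x ^ 2) ^ 2 := by
    rw [← integral_sub (hint _) (hint _)]
    exact (abs_integral_le_integral_abs).trans
      (integral_abs_capInd_sub_le hν hsm hs ht (pow_pos hx0 2) (hunit K _ (hπ K)) v)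
  have hdist : ‖π K - v‖ ≤ x ^ 3 := by rw [norm_sub_rev]; exact hvπ K
  have hpop' : ‖π K - v‖ ^ 2 / (x ^ 2) ^ 2 ≤ x ^ 2 := by
    calc ‖π K - v‖ ^ 2 / (x ^ 2) ^ 2 ≤ (x ^ 3) ^ 2 / (x ^ 2) ^ 2 := by gcongr
      _ = x ^ 2 := by field_simp
  have hstrip : empMean z (stripInd t (x ^ 2) (π K))
      ≤ 2 * x ^ 2 + r * ((13 * K + 18 + B) * x) := by
    have h1 := hlevel K le_rfl (stripInd t (x ^ 2) (π K))
      (Finset.mem_union_right _ (Finset.mem_image_of_mem _ (hπ K)))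
    have h2 := integral_stripInd_le hν (hunit K _ (hπ K)) t (pow_pos hx0 2).le
    have h3 : ∫ z, stripInd t (x ^ 2) (π K) z ∂ν ≤ ∫ z, |stripInd t (x ^ 2) (π K) z| ∂ν :=
      (le_abs_self _).trans abs_integral_le_integral_abs
    linarith [(abs_le.1 h1).2]
  have hop : (x ^ 2)⁻¹ * empMean z (fun y => |inner ℝ (π K - v) y.1|) ≤ 2 * (6 + B) * x := by
    have h1 := sum_abs_inner_le_of_net (fun i => (z i).1) hM hnet (π K - v)
    have h2 : ∑ i, |inner ℝ (π K - v) (z i).1| ≤ 2 * ((6 + B) * n) * x ^ 3 :=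
      h1.trans (by gcongr)
    calc (x ^ 2)⁻¹ * ((1 / (n : ℝ)) * ∑ i, |inner ℝ (π K - v) (z i).1|)
        ≤ (x ^ 2)⁻¹ * ((1 / (n : ℝ)) * (2 * ((6 + B) * n) * x ^ 3)) := by gcongr
      _ = 2 * (6 + B) * x := by field_simp
  have hxx : x ^ 2 ≤ x := by nlinarith
  have h1 : r * (62 + 2 * B - (26 * K + 62 + 2 * B) * x) ≤ r * (62 + 2 * B) := by
    have : 0 ≤ (26 * K + 62 + 2 * B) * x := by positivity
    exact mul_le_mul_of_nonneg_left (by linarith) hr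
  have h2 : r * ((13 * K + 18 + B) * x) ≤ r * (31 + B) := by
    refine mul_le_mul_of_nonneg_left ?_ hr
    nlinarith
  have h3 : 2 * (6 + B) * x ≤ 2 * (6 + B) * (2 * r) := by gcongr
  rw [abs_le] at hend hemp hpop ⊢
  constructor <;> linarith [hend.1, hend.2, hemp.1, hemp.2, hpop.1, hpop.2]

/-- Uniform deviation of the empirical masses of the caps `{t ≤ s * vᵀx}`, at the rate
`√(p / n)`. -/
theorem exists_uniform_deviation {α : ℝ} (hα : 0 < α) :
    ∃ C : ℝ, 0 < C ∧ ∀ (n p : ℕ), 0 < p → p ≤ n →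
      ∀ {Ω : Type*} [MeasurableSpace Ω] (μ : Measure Ω) [IsProbabilityMeasure μ]
        (ν : Measure (EuclideanSpace ℝ (Fin p) × ℝ))
        (W : Fin n → Ω → EuclideanSpace ℝ (Fin p) × ℝ),
      (∀ i, HasLaw (W i) ν μ) → iIndepFun W μ →
      ν.map Prod.fst = stdGaussian (EuclideanSpace ℝ (Fin p)) →
      ∀ (s : EuclideanSpace ℝ (Fin p) × ℝ → ℝ), Measurable s →
      (∀ z, s z = -1 ∨ s z = 0 ∨ s z = 1) → ∀ t : ℝ, 0 < t →
      μ {ω | ∃ v : EuclideanSpace ℝ (Fin p), ‖v‖ = 1 ∧ C * √((p : ℝ) / n)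
          < |empMean (fun i => W i ω) (capInd s t v) - ∫ z, capInd s t v z ∂ν|}
        ≤ ENNReal.ofReal α := by
  -- The failure probabilities are 4 exp(-B) for all levels, 2 exp(-B) for the base and exp(-B) for
  -- the net, hence 7.
  set B : ℝ := |Real.log (7 / α)| with hBdef
  have hB : 0 ≤ B := abs_nonneg _
  have hBα : 7 * Real.exp (-B) ≤ α := by
    have h1 : Real.log (7 / α) ≤ B := le_abs_self _
    have h2 : Real.exp (-B) ≤ Real.exp (-Real.log (7 / α)) := Real.exp_le_exp.2 (by linarith)
    rw [Real.exp_neg (Real.log _), Real.exp_log (by positivity), inv_div] at h2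
    linarith
  refine ⟨140 + 8 * B, by positivity, ?_⟩
  intro n p hp hpn Ω _ μ _ ν W hW hind hν s hsm hs t ht
  have hn : 0 < n := hp.trans_le hpn
  have hn' : (0 : ℝ) < n := by exact_mod_cast hn
  have hp' : (0 : ℝ) < p := by exact_mod_cast hp
  have hprob : IsProbabilityMeasure ν := (hW ⟨0, hn⟩).isProbabilityMeasure_iff.1 inferInstance
  choose N hNcard hNunit hNcov using fun k => exists_sphereCover p (3 * k)
  obtain ⟨M, hMcard, hMunit, hMcov⟩ := exists_sphereCover p 1
  have hr0 : 0 < √((p : ℝ) / n) := Real.sqrt_pos.2 (by positivity)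
  have hr1 : √((p : ℝ) / n) ≤ 1 :=
    Real.sqrt_le_one.2 ((div_le_one hn').2 (by exact_mod_cast hpn))
  -- The last level K satisfies r ≤ 2^(-K) < 2r: the lower bound keeps the Bernstein parameter at
  -- most 1, the upper one makes the remainder O(r).
  obtain ⟨K, hK1, hK2⟩ := exists_nat_pow_near_of_lt_one hr0 hr1 (y := 1 / 2) (by norm_num)
    (by norm_num)
  set r := √((p : ℝ) / n) with hr
  let bad : ℕ → Set Ω := fun k => {ω | ∃ h ∈ chainFamily s t (N k) (N (k + 1)) k,
    r * ((13 * k + 18 + B) * (1 / 2) ^ k) < |empMean (fun i => W i ω) h - ∫ z, h z ∂ν|}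
  let badBase : Set Ω := {ω | ∃ a ∈ N 0, r * (13 + B)
    < |empMean (fun i => W i ω) (capInd s t a) - ∫ z, capInd s t a z ∂ν|}
  let badNet : Set Ω := {ω | ∃ a ∈ M, (6 + B) * n < ∑ i, |inner ℝ a (W i ω).1|}
  have hsub : {ω | ∃ v : EuclideanSpace ℝ (Fin p), ‖v‖ = 1 ∧ (140 + 8 * B) * r
      < |empMean (fun i => W i ω) (capInd s t v) - ∫ z, capInd s t v z ∂ν|}
      ⊆ (⋃ k ∈ Finset.range (K + 1), bad k) ∪ (badBase ∪ badNet) := by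
    rintro ω ⟨v, hv, hω⟩
    by_contra hgood
    simp only [Set.mem_union, Set.mem_iUnion, not_or, not_exists] at hgood
    obtain ⟨hg1, hg2, hg3⟩ := hgood
    refine absurd hω (not_lt.2 ?_)
    refine abs_empMean_capInd_sub_le_of_chain (N := N) (M := M) (K := K) hn hν hsm hs ht hB
      (fun i => W i ω) hr0.le ?_ hNunit ?_ ?_ ?_ ?_ ?_ hv
    · rw [pow_succ] at hK1; linarith
    · intro k v hv
      rw [← pow_mul, mul_comm k 3]
      exact hNcov k v hv
    · simpa using hMcov
    · intro a ha
      exact not_lt.1 fun h => hg2 ⟨a, ha, h⟩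
    · intro k hk h hh
      exact not_lt.1 fun h' => hg1 k (Finset.mem_range.2 (by omega)) ⟨h, hh, h'⟩
    · intro a ha
      exact not_lt.1 fun h => hg3 ⟨a, ha, h⟩
  have hbad : μ (⋃ k ∈ Finset.range (K + 1), bad k) ≤ ENNReal.ofReal (4 * Real.exp (-B)) := by
    refine (measure_biUnion_finset_le _ _).trans ?_
    have h1 : ∀ k ∈ Finset.range (K + 1),
        μ (bad k) ≤ ENNReal.ofReal (2 * Real.exp (-B) * (1 / 2) ^ k) := by
      intro k hk
      refine measure_chainFamily_le hn hp hW hind hν hsm hs ht hB (hNcard k) (hNcard (k + 1))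
        (hNunit k) (hK2.trans ?_)
      exact pow_le_pow_of_le_one (by norm_num) (by norm_num)
        (Nat.lt_succ_iff.1 (Finset.mem_range.1 hk))
    refine (Finset.sum_le_sum h1).trans ?_
    rw [← ENNReal.ofReal_sum_of_nonneg fun _ _ => by positivity, ← Finset.mul_sum]
    refine ENNReal.ofReal_le_ofReal ?_
    have h2 : ∑ k ∈ Finset.range (K + 1), (1 / 2 : ℝ) ^ k ≤ 2 := sum_geometric_two_le _
    nlinarith [Real.exp_pos (-B)]
  have hbase : μ badBase ≤ ENNReal.ofReal (2 * Real.exp (-B)) :=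
    measure_capInd_net_le hn hp hpn hW hind hsm hB (hNcard 0)
  have hnet : μ badNet ≤ ENNReal.ofReal (Real.exp (-B)) :=
    measure_sum_abs_inner_net_le hn hpn hW hind hν hB hMcard hMunit
  calc _ ≤ μ ((⋃ k ∈ Finset.range (K + 1), bad k) ∪ (badBase ∪ badNet)) := measure_mono hsub
    _ ≤ μ (⋃ k ∈ Finset.range (K + 1), bad k) + (μ badBase + μ badNet) :=
        (measure_union_le _ _).trans (add_le_add le_rfl (measure_union_le _ _))
    _ ≤ ENNReal.ofReal (4 * Real.exp (-B)) + (ENNReal.ofReal (2 * Real.exp (-B))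
        + ENNReal.ofReal (Real.exp (-B))) := add_le_add hbad (add_le_add hbase hnet)
    _ = ENNReal.ofReal (7 * Real.exp (-B)) := by
        rw [← ENNReal.ofReal_add (by positivity) (by positivity),
          ← ENNReal.ofReal_add (by positivity) (by positivity)]
        congr 1
        ring
    _ ≤ ENNReal.ofReal α := ENNReal.ofReal_le_ofReal hBα

end UniformDeviation

/-! ### From depth regions to signed caps -/

section Depth

variable {n p : ℕ}

/-- The sign of the residual `y - xᵀβ`. -/
def residualSign (β : EuclideanSpace ℝ (Fin p)) (z : EuclideanSpace ℝ (Fin p) × ℝ) : ℝ :=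
  if 0 ≤ z.2 - inner ℝ z.1 β then 1 else -1

/-- The sign of the residual `y - xᵀβ` where it is at least `r` in absolute value, else `0`. -/
def largeResidualSign (β : EuclideanSpace ℝ (Fin p)) (r : ℝ)
    (z : EuclideanSpace ℝ (Fin p) × ℝ) : ℝ :=
  if r ≤ z.2 - inner ℝ z.1 β then 1 else if z.2 - inner ℝ z.1 β ≤ -r then -1 else 0

theorem measurable_residualSign (β : EuclideanSpace ℝ (Fin p)) :
    Measurable (residualSign β) :=
  Measurable.ite (measurableSet_le measurable_const (by fun_prop)) measurable_const
    measurable_const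

theorem measurable_largeResidualSign (β : EuclideanSpace ℝ (Fin p)) (r : ℝ) :
    Measurable (largeResidualSign β r) :=
  Measurable.ite (measurableSet_le measurable_const (by fun_prop)) measurable_const
    (Measurable.ite (measurableSet_le (by fun_prop) measurable_const) measurable_const
      measurable_const)

theorem residualSign_mem (β : EuclideanSpace ℝ (Fin p)) (z : EuclideanSpace ℝ (Fin p) × ℝ) :
    residualSign β z = -1 ∨ residualSign β z = 0 ∨ residualSign β z = 1 := by
  unfold residualSign
  split_ifs <;> simp

theorem largeResidualSign_mem (β : EuclideanSpace ℝ (Fin p)) (r : ℝ)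
    (z : EuclideanSpace ℝ (Fin p) × ℝ) :
    largeResidualSign β r z = -1 ∨ largeResidualSign β r z = 0 ∨ largeResidualSign β r z = 1 := by
  unfold largeResidualSign
  split_ifs <;> simp

/-- Only this inclusion is needed, since the depth at `β` is bounded from below; zero residuals may
be given either sign. -/
theorem cap_residualSign_subset (β v : EuclideanSpace ℝ (Fin p)) {t : ℝ} (ht : 0 < t) :
    {z | t ≤ residualSign β z * inner ℝ v z.1} ⊆ truncSet v β t := by
  intro z hz
  rw [Set.mem_ofPred_eq] at hz
  unfold residualSign at hz
  split_ifs at hz with h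
  · rw [one_mul] at hz
    exact ⟨mul_nonneg (ht.le.trans hz) h, hz.trans (le_abs_self _)⟩
  · refine ⟨mul_nonneg_of_nonpos_of_nonpos (by linarith) (not_le.1 h).le, ?_⟩
    rw [neg_one_mul] at hz
    exact hz.trans (neg_le_abs _)

/-- In the direction of the error, the points counted by the depth of `b` have a large residual
whose sign is that of `vᵀx`. -/
theorem truncSet_subset_cap_largeResidualSign (β b : EuclideanSpace ℝ (Fin p)) {t R : ℝ}
    (ht : 0 < t) (hR : 0 < R) (hb : R < ‖b - β‖) :
    truncSet (‖b - β‖⁻¹ • (b - β)) b t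
      ⊆ {z | t ≤ largeResidualSign β (R * t) z * inner ℝ (‖b - β‖⁻¹ • (b - β)) z.1} := by
  intro z hz
  obtain ⟨h1, h2⟩ := hz
  have hpos : 0 < ‖b - β‖ := hR.trans hb
  have hres : z.2 - inner ℝ z.1 b
      = (z.2 - inner ℝ z.1 β) - ‖b - β‖ * inner ℝ (‖b - β‖⁻¹ • (b - β)) z.1 := by
    rw [real_inner_smul_left, mul_inv_cancel_left₀ hpos.ne', inner_sub_left,
      real_inner_comm z.1 b, real_inner_comm z.1 β]
    ring
  rw [hres] at h1
  rw [Set.mem_ofPred_eq]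
  set g : ℝ := inner ℝ (‖b - β‖⁻¹ • (b - β)) z.1 with hg
  have hRt : 0 < R * t := mul_pos hR ht
  unfold largeResidualSign
  rcases le_abs.1 h2 with h3 | h3
  · have h4 : 0 ≤ (z.2 - inner ℝ z.1 β) - ‖b - β‖ * g :=
      nonneg_of_mul_nonneg_right h1 (ht.trans_le h3)
    -- The residual at `β` is at least ‖b - β‖ g, and the truncation g ≥ t makes this at least `R *
    -- t`, a threshold free of `b`.
    have h5 : R * t ≤ ‖b - β‖ * g := mul_le_mul hb.le h3 ht.le hpos.le
    rw [if_pos (by linarith), one_mul]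
    exact h3
  · have h4 : (z.2 - inner ℝ z.1 β) - ‖b - β‖ * g ≤ 0 := by
      by_contra h
      have : g * ((z.2 - inner ℝ z.1 β) - ‖b - β‖ * g) < 0 :=
        mul_neg_of_neg_of_pos (by linarith) (not_le.1 h)
      linarith
    have h5 : R * t ≤ ‖b - β‖ * -g := mul_le_mul hb.le h3 ht.le hpos.le
    rw [if_neg (by linarith), if_pos (by linarith), neg_one_mul]
    exact h3

theorem empTruncDepth_le (x : Fin n → EuclideanSpace ℝ (Fin p)) (y : Fin n → ℝ) (t : ℝ)
    (b : EuclideanSpace ℝ (Fin p)) {v : EuclideanSpace ℝ (Fin p)} (hv : ‖v‖ = 1) :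
    empTruncDepth x y t b
      ≤ empMean (fun i => (x i, y i)) ((truncSet v b t).indicator fun _ => 1) := by
  refine ciInf_le (f := fun v : Metric.sphere (0 : EuclideanSpace ℝ (Fin p)) 1 =>
    (1 / (n : ℝ)) * ∑ i, (truncSet (v : EuclideanSpace ℝ (Fin p)) b t).indicator
      (fun _ => (1 : ℝ)) (x i, y i)) ⟨0, ?_⟩ ⟨v, mem_sphere_zero_iff_norm.2 hv⟩
  rintro _ ⟨w, rfl⟩
  exact mul_nonneg (by positivity) (Finset.sum_nonneg fun i _ => indicator_one_nonneg _ _)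

theorem le_empTruncDepth (x : Fin n → EuclideanSpace ℝ (Fin p)) (y : Fin n → ℝ) (t : ℝ)
    (b : EuclideanSpace ℝ (Fin p)) [Nonempty (Metric.sphere (0 : EuclideanSpace ℝ (Fin p)) 1)]
    {m : ℝ} (hm : ∀ v : EuclideanSpace ℝ (Fin p), ‖v‖ = 1 →
      m ≤ empMean (fun i => (x i, y i)) ((truncSet v b t).indicator fun _ => 1)) :
    m ≤ empTruncDepth x y t b :=
  le_ciInf fun v => hm v (mem_sphere_zero_iff_norm.1 v.2)

end Depth

/-! ### Population masses under contamination -/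

section Population

variable {p : ℕ} {β : EuclideanSpace ℝ (Fin p)} {σ ε : ℝ}
  {Q : Kernel (EuclideanSpace ℝ (Fin p)) ℝ} [IsMarkovKernel Q]

theorem adaptiveLaw_map_fst (h0 : 0 ≤ ε) (h1 : ε ≤ 1) :
    (adaptiveLaw β σ ε Q).map Prod.fst = stdGaussian (EuclideanSpace ℝ (Fin p)) := by
  have := isMarkovKernel_responseKernel β σ ε Q h0 h1
  exact Measure.fst_compProd _ _

theorem adaptiveLaw_apply (h0 : 0 ≤ ε) (h1 : ε ≤ 1)
    {S : Set (EuclideanSpace ℝ (Fin p) × ℝ)} (hS : MeasurableSet S) :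
    adaptiveLaw β σ ε Q S = ∫⁻ x, (ENNReal.ofReal (1 - ε) *
      gaussianReal (inner ℝ x β) (Real.toNNReal (σ ^ 2)) (Prod.mk x ⁻¹' S)
      + ENNReal.ofReal ε * Q x (Prod.mk x ⁻¹' S))
      ∂(stdGaussian (EuclideanSpace ℝ (Fin p))) := by
  have := isMarkovKernel_responseKernel β σ ε Q h0 h1
  exact Measure.compProd_apply hS

theorem le_adaptiveLaw_real (h0 : 0 ≤ ε) (h1 : ε ≤ 1)
    {S : Set (EuclideanSpace ℝ (Fin p) × ℝ)} (hS : MeasurableSet S)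
    {D : Set (EuclideanSpace ℝ (Fin p))} (hD : MeasurableSet D) {c : ℝ} (hc : 0 ≤ c)
    (hx : ∀ x ∈ D,
      c ≤ (gaussianReal (inner ℝ x β) (Real.toNNReal (σ ^ 2))).real (Prod.mk x ⁻¹' S)) :
    (1 - ε) * c * (stdGaussian (EuclideanSpace ℝ (Fin p))).real D
      ≤ (adaptiveLaw β σ ε Q).real S := by
  have hM := isMarkovKernel_responseKernel β σ ε Q h0 h1
  have : IsProbabilityMeasure (adaptiveLaw β σ ε Q) := by unfold adaptiveLaw; infer_instance
  have key : ENNReal.ofReal ((1 - ε) * c) * stdGaussian (EuclideanSpace ℝ (Fin p)) D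
      ≤ adaptiveLaw β σ ε Q S := by
    rw [adaptiveLaw_apply h0 h1 hS, ← lintegral_indicator_const hD]
    refine lintegral_mono fun x => ?_
    by_cases hxD : x ∈ D
    · rw [Set.indicator_of_mem hxD, ENNReal.ofReal_mul (by linarith)]
      refine le_add_right (mul_le_mul_right ?_ _)
      exact ENNReal.ofReal_le_of_le_toReal (hx x hxD)
    · rw [Set.indicator_of_notMem hxD]
      exact zero_le
  have h2 := ENNReal.toReal_mono (measure_ne_top _ _) key
  rwa [ENNReal.toReal_mul, ENNReal.toReal_ofReal (mul_nonneg (by linarith) hc)] at h2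

/-- The contaminating law is bounded by 1, but only over `D`: its cost is ε times the mass of `D`
rather than ε. This is where truncation limits the adversary. -/
theorem adaptiveLaw_real_le (h0 : 0 ≤ ε) (h1 : ε ≤ 1)
    {S : Set (EuclideanSpace ℝ (Fin p) × ℝ)} (hS : MeasurableSet S)
    {D : Set (EuclideanSpace ℝ (Fin p))} (hD : MeasurableSet D) {c : ℝ} (hc : 0 ≤ c)
    (hx : ∀ x ∈ D,
      (gaussianReal (inner ℝ x β) (Real.toNNReal (σ ^ 2))).real (Prod.mk x ⁻¹' S) ≤ c)
    (hxD : ∀ z ∈ S, z.1 ∈ D) :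
    (adaptiveLaw β σ ε Q).real S
      ≤ ((1 - ε) * c + ε) * (stdGaussian (EuclideanSpace ℝ (Fin p))).real D := by
  have hnn : 0 ≤ (1 - ε) * c := mul_nonneg (by linarith) hc
  have key : adaptiveLaw β σ ε Q S
      ≤ ENNReal.ofReal ((1 - ε) * c + ε) * stdGaussian (EuclideanSpace ℝ (Fin p)) D := by
    rw [adaptiveLaw_apply h0 h1 hS, ← lintegral_indicator_const hD]
    refine lintegral_mono fun x => ?_
    by_cases hxD' : x ∈ D
    · rw [Set.indicator_of_mem hxD', ENNReal.ofReal_add hnn h0, ENNReal.ofReal_mul (by linarith)]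
      refine add_le_add (mul_le_mul_right ?_ _) (mul_le_of_le_one_right' prob_le_one)
      exact (ENNReal.le_ofReal_iff_toReal_le (measure_ne_top _ _) hc).2 (hx x hxD')
    · have hempty : Prod.mk x ⁻¹' S = ∅ :=
        Set.eq_empty_of_forall_notMem fun y hy => hxD' (hxD _ hy)
      simp [hempty]
  have h2 := ENNReal.toReal_mono
    (ENNReal.mul_ne_top ENNReal.ofReal_ne_top (measure_ne_top _ _)) key
  rwa [ENNReal.toReal_mul, ENNReal.toReal_ofReal (by linarith)] at h2

theorem measurableSet_abs_ge (t : ℝ) : MeasurableSet {g : ℝ | t ≤ |g|} :=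
  measurableSet_le measurable_const (by fun_prop)

theorem gaussianReal_real_residual (m : ℝ) (hσ : 0 < σ) {s : Set ℝ} (hs : MeasurableSet s) :
    (gaussianReal m (Real.toNNReal (σ ^ 2))).real {y | (y - m) / σ ∈ s}
      = (gaussianReal 0 1).real s := by
  rw [Measure.real, gaussianReal_standardize m hσ hs]
  rfl

/-- For each x with |vᵀx| ≥ t, the clean residual has the sign of vᵀx with probability 1/2; the
contaminated part is discarded. -/
theorem le_integral_capInd_residualSign (hσ : 0 < σ) (h0 : 0 ≤ ε) (h1 : ε ≤ 1) {t : ℝ}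
    {v : EuclideanSpace ℝ (Fin p)} (hv : ‖v‖ = 1) :
    (1 - ε) * (1 / 2) * (gaussianReal 0 1).real {g | t ≤ |g|}
      ≤ ∫ z, capInd (residualSign β) t v z ∂(adaptiveLaw β σ ε Q) := by
  have hS := measurableSet_cap (measurable_residualSign β) t v
  have hint : ∫ z, capInd (residualSign β) t v z ∂(adaptiveLaw β σ ε Q)
      = (adaptiveLaw β σ ε Q).real {z | t ≤ residualSign β z * inner ℝ v z.1} :=
    integral_indicator_one hS
  rw [hint, ← stdGaussian_real_inner_mem hv (measurableSet_abs_ge t)]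
  refine le_adaptiveLaw_real h0 h1 hS (measurableSet_far t v) (by norm_num) fun x hx => ?_
  rcases le_abs.1 (show t ≤ |inner ℝ v x| from hx) with h | h
  · rw [← gaussianReal_real_Ici_zero, ← gaussianReal_real_residual (inner ℝ x β) hσ
      measurableSet_Ici]
    refine measureReal_mono fun y hy => ?_
    have hy' : 0 ≤ y - inner ℝ x β := by
      have : 0 ≤ (y - inner ℝ x β) / σ := hy
      simpa using (le_div_iff₀ hσ).1 this
    change t ≤ residualSign β (x, y) * inner ℝ v x
    rw [residualSign, if_pos hy', one_mul]
    exact h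
  · rw [← gaussianReal_real_Iio_zero, ← gaussianReal_real_residual (inner ℝ x β) hσ
      measurableSet_Iio]
    refine measureReal_mono fun y hy => ?_
    have hy' : ¬ 0 ≤ y - inner ℝ x β := by
      have : (y - inner ℝ x β) / σ < 0 := hy
      simpa using (div_lt_iff₀ hσ).1 this
    change t ≤ residualSign β (x, y) * inner ℝ v x
    rw [residualSign, if_neg hy', neg_one_mul]
    exact h

/-- Given x, the clean residual must lie in one Gaussian tail beyond r; `r ≤ σ` keeps the tail bound
linear in r / σ. -/
theorem integral_capInd_largeResidualSign_le (hσ : 0 < σ) (h0 : 0 ≤ ε) (h1 : ε ≤ 1) {t r : ℝ}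
    (ht : 0 < t) (hr0 : 0 < r) (hr1 : r ≤ σ) {v : EuclideanSpace ℝ (Fin p)} (hv : ‖v‖ = 1) :
    ∫ z, capInd (largeResidualSign β r) t v z ∂(adaptiveLaw β σ ε Q)
      ≤ ((1 - ε) * (1 / 2 - r / σ / 6) + ε) * (gaussianReal 0 1).real {g | t ≤ |g|} := by
  have hS := measurableSet_cap (measurable_largeResidualSign β r) t v
  have ha0 : 0 ≤ r / σ := by positivity
  have ha1 : r / σ ≤ 1 := (div_le_one hσ).2 hr1
  have hint : ∫ z, capInd (largeResidualSign β r) t v z ∂(adaptiveLaw β σ ε Q)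
      = (adaptiveLaw β σ ε Q).real {z | t ≤ largeResidualSign β r z * inner ℝ v z.1} :=
    integral_indicator_one hS
  rw [hint, ← stdGaussian_real_inner_mem hv (measurableSet_abs_ge t)]
  refine adaptiveLaw_real_le h0 h1 hS (measurableSet_far t v) (by linarith) (fun x hx => ?_) ?_
  · rcases le_abs.1 (show t ≤ |inner ℝ v x| from hx) with h | h
    · refine le_trans ?_ (gaussianReal_real_Ici_le ha0 ha1)
      rw [← gaussianReal_real_residual (inner ℝ x β) hσ measurableSet_Ici]
      refine measureReal_mono fun y hy => ?_
      have hy' : t ≤ largeResidualSign β r (x, y) * inner ℝ v x := hy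
      change r / σ ≤ (y - inner ℝ x β) / σ
      gcongr
      unfold largeResidualSign at hy'
      split_ifs at hy' with h2 h3
      · exact h2
      · linarith
      · linarith
    · refine le_trans ?_ (gaussianReal_real_Iic_neg_le ha0 ha1)
      rw [← gaussianReal_real_residual (inner ℝ x β) hσ measurableSet_Iic]
      refine measureReal_mono fun y hy => ?_
      have hy' : t ≤ largeResidualSign β r (x, y) * inner ℝ v x := hy
      change (y - inner ℝ x β) / σ ≤ -(r / σ)
      rw [← neg_div]
      gcongr
      unfold largeResidualSign at hy'
      split_ifs at hy' with h2 h3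
      · linarith
      · exact h3
      · linarith
  · intro z hz
    rw [Set.mem_ofPred_eq] at hz
    change t ≤ |inner ℝ v z.1|
    rcases largeResidualSign_mem β r z with h | h | h <;> rw [h] at hz
    · exact (by linarith : t ≤ -inner ℝ v z.1).trans (neg_le_abs _)
    · linarith
    · exact (by linarith : t ≤ inner ℝ v z.1).trans (le_abs_self _)

end Population

/-! ### The error bound at a fixed truncation level -/

section Main

variable {n p : ℕ} {β : EuclideanSpace ℝ (Fin p)} {σ ε : ℝ}
  {Q : Kernel (EuclideanSpace ℝ (Fin p)) ℝ} [IsMarkovKernel Q]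

/-- On the event that both families of caps deviate by at most `δ`, a depth maximizer is within
`R` of the truth. -/
theorem norm_sub_le_of_isDepthMaximizer (hσ : 0 < σ) (h0 : 0 ≤ ε) (h1 : ε < 1 / 2)
    {x : Fin n → EuclideanSpace ℝ (Fin p)} {y : Fin n → ℝ} {t R δ : ℝ} (ht : 0 < t) (hR : 0 < R)
    (hRt : R * t ≤ σ)
    (hlow : ∀ v : EuclideanSpace ℝ (Fin p), ‖v‖ = 1 →
      |empMean (fun i => (x i, y i)) (capInd (residualSign β) t v)
        - ∫ z, capInd (residualSign β) t v z ∂(adaptiveLaw β σ ε Q)| ≤ δ)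
    (hupp : ∀ v : EuclideanSpace ℝ (Fin p), ‖v‖ = 1 →
      |empMean (fun i => (x i, y i)) (capInd (largeResidualSign β (R * t)) t v)
        - ∫ z, capInd (largeResidualSign β (R * t)) t v z ∂(adaptiveLaw β σ ε Q)| ≤ δ)
    (hδ : ε * (gaussianReal 0 1).real {g | t ≤ |g|} + 2 * δ
      < (gaussianReal 0 1).real {g | t ≤ |g|} * (R * t / σ) / 12)
    {b : EuclideanSpace ℝ (Fin p)} (hb : IsDepthMaximizer x y t b) : ‖b - β‖ ≤ R := by
  by_contra! hfar
  have hpos : 0 < ‖b - β‖ := hR.trans hfar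
  have hv : ‖(‖b - β‖⁻¹ • (b - β))‖ = 1 := by
    rw [norm_smul, norm_inv, norm_norm, inv_mul_cancel₀ hpos.ne']
  have : Nonempty (Metric.sphere (0 : EuclideanSpace ℝ (Fin p)) 1) :=
    ⟨⟨_, mem_sphere_zero_iff_norm.2 hv⟩⟩
  set q : ℝ := (gaussianReal 0 1).real {g | t ≤ |g|} with hq
  have hq0 : 0 ≤ q := measureReal_nonneg
  have hlo : (1 - ε) * (1 / 2) * q - δ ≤ empTruncDepth x y t β := by
    refine le_empTruncDepth x y t β fun v hv => ?_
    have h2 := le_integral_capInd_residualSign (β := β) (Q := Q) (t := t) hσ h0 (by linarith) hv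
    have h3 : empMean (fun i => (x i, y i)) (capInd (residualSign β) t v)
        ≤ empMean (fun i => (x i, y i)) ((truncSet v β t).indicator fun _ => 1) :=
      empMean_mono _ fun i => Set.indicator_le_indicator_of_subset
        (cap_residualSign_subset β v ht) (fun _ => zero_le_one) _
    linarith [(abs_le.1 (hlow v hv)).1]
  have hup : empTruncDepth x y t b ≤ ((1 - ε) * (1 / 2 - R * t / σ / 6) + ε) * q + δ := by
    refine (empTruncDepth_le x y t b hv).trans ?_
    have h2 := integral_capInd_largeResidualSign_le (β := β) (Q := Q) hσ h0 (by linarith) ht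
      (mul_pos hR ht) hRt hv
    have h3 : empMean (fun i => (x i, y i))
          ((truncSet (‖b - β‖⁻¹ • (b - β)) b t).indicator fun _ => 1)
        ≤ empMean (fun i => (x i, y i))
          (capInd (largeResidualSign β (R * t)) t (‖b - β‖⁻¹ • (b - β))) :=
      empMean_mono _ fun i => Set.indicator_le_indicator_of_subset
        (truncSet_subset_cap_largeResidualSign β b ht hR hfar) (fun _ => zero_le_one) _
    linarith [(abs_le.1 (hupp _ hv)).2]
  have hmax := hb β
  have ha : 0 ≤ q * (R * t / σ) := by positivity
  -- The depth gap is (1 - ε) q R t / (6σ), and 1 - ε > 1/2 gives the factor 1/12 of `hδ`.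
  nlinarith

/-- The error bound for every truncation level at which it is less than a constant times
`σ / t`. -/
theorem exists_measure_depth_error_le {α : ℝ} (hα : 0 < α) :
    ∃ C : ℝ, 1 ≤ C ∧ ∀ (n p : ℕ), 0 < p → p ≤ n →
      ∀ (β : EuclideanSpace ℝ (Fin p)) (σ ε : ℝ), 0 < σ → 0 ≤ ε → ε < 1 / 2 →
      ∀ (Q : Kernel (EuclideanSpace ℝ (Fin p)) ℝ) [IsMarkovKernel Q]
        {Ω : Type*} [MeasurableSpace Ω] (μ : Measure Ω) [IsProbabilityMeasure μ]
        (X : Fin n → Ω → EuclideanSpace ℝ (Fin p)) (y : Fin n → Ω → ℝ),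
      IsAdaptiveSample μ β σ ε Q X y → ∀ t : ℝ, 0 < t →
      C * (√((p : ℝ) / n) * Real.exp (t ^ 2) + ε) ≤ 1 →
      ∀ βhat : Ω → EuclideanSpace ℝ (Fin p),
        (∀ᵐ ω ∂μ, IsDepthMaximizer (fun i => X i ω) (fun i => y i ω) t (βhat ω)) →
        μ {ω | ¬ ‖βhat ω - β‖ ≤ C * (σ / t) * (√((p : ℝ) / n) * Real.exp (t ^ 2) + ε)}
          ≤ ENNReal.ofReal α := by
  -- Half of α for each of the two families of caps. Below, the two summands of 24 + 24 C₀ / c₁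
  -- absorb εq and 2 C₀ r respectively, the latter through c₁ ≤ q exp(t²).
  obtain ⟨C₀, hC₀, hdev⟩ := exists_uniform_deviation (half_pos hα)
  set c₁ : ℝ := Real.exp (-1) / 3 with hc₁
  have hc₁0 : 0 < c₁ := by positivity
  refine ⟨24 + 24 * C₀ / c₁, by have : 0 < 24 * C₀ / c₁ := by positivity
                                linarith, ?_⟩
  intro n p hp hpn β σ ε hσ h0 h1 Q _ Ω _ μ _ X y hsample t ht hsmall βhat hmax
  set C : ℝ := 24 + 24 * C₀ / c₁ with hC
  have hC0 : 0 < C := by positivity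
  have hn' : (0 : ℝ) < n := by exact_mod_cast hp.trans_le hpn
  have hp' : (0 : ℝ) < p := by exact_mod_cast hp
  set r : ℝ := √((p : ℝ) / n) with hr
  have hr0 : 0 < r := Real.sqrt_pos.2 (by positivity)
  set R : ℝ := C * (σ / t) * (r * Real.exp (t ^ 2) + ε) with hRdef
  have hsum : 0 < r * Real.exp (t ^ 2) + ε := by positivity
  have hR : 0 < R := by positivity
  have hRt : R * t = C * (r * Real.exp (t ^ 2) + ε) * σ := by
    rw [hRdef]; field_simp
  have hδ : ε * (gaussianReal 0 1).real {g | t ≤ |g|} + 2 * (C₀ * r)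
      < (gaussianReal 0 1).real {g | t ≤ |g|} * (R * t / σ) / 12 := by
    have hq := exp_le_gaussianReal_real_abs_ge ht.le
    set q : ℝ := (gaussianReal 0 1).real {g | t ≤ |g|} with hq'
    have hq1 : c₁ ≤ q * Real.exp (t ^ 2) := by
      calc c₁ = c₁ * Real.exp (-t ^ 2) * Real.exp (t ^ 2) := by
            rw [mul_assoc, ← Real.exp_add, neg_add_cancel, Real.exp_zero, mul_one]
        _ ≤ q * Real.exp (t ^ 2) := mul_le_mul_of_nonneg_right hq (Real.exp_pos _).le
    have hq0 : 0 ≤ q := measureReal_nonneg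
    have hCc : C * c₁ = 24 * c₁ + 24 * C₀ := by rw [hC]; field_simp
    have e1 : R * t / σ = C * (r * Real.exp (t ^ 2) + ε) := by
      rw [hRt]; field_simp
    rw [e1]
    have h24 : 24 ≤ C := by
      have : 0 < 24 * C₀ / c₁ := by positivity
      linarith
    have e2 : (24 * c₁ + 24 * C₀) * r ≤ C * (q * Real.exp (t ^ 2)) * r := by
      rw [← hCc]; gcongr
    have e3 : 24 * (q * ε) ≤ C * (q * ε) := by gcongr
    have e4 : 0 < c₁ * r := by positivity
    have e5 : 0 ≤ q * ε := by positivity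
    nlinarith
  have hfst := adaptiveLaw_map_fst (β := β) (σ := σ) (Q := Q) h0 (by linarith)
  have hb1 := hdev n p hp hpn μ (adaptiveLaw β σ ε Q) (fun i ω => (X i ω, y i ω)) hsample.hasLaw
    hsample.indep hfst (residualSign β) (measurable_residualSign β) (residualSign_mem β) t ht
  have hb2 := hdev n p hp hpn μ (adaptiveLaw β σ ε Q) (fun i ω => (X i ω, y i ω)) hsample.hasLaw
    hsample.indep hfst (largeResidualSign β (R * t)) (measurable_largeResidualSign β _)
    (largeResidualSign_mem β _) t ht
  have hb3 : μ {ω | ¬ IsDepthMaximizer (fun i => X i ω) (fun i => y i ω) t (βhat ω)} = 0 := hmax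
  refine (measure_mono ?_).trans ((measure_union_le _ _).trans
    ((add_le_add ((measure_union_le _ _).trans (add_le_add hb1 hb2)) hb3.le).trans_eq ?_))
  · intro ω hω
    by_contra hgood
    simp only [Set.mem_union, not_or, Set.mem_ofPred_eq, not_exists, not_and, not_lt,
      not_not] at hgood
    obtain ⟨⟨hg1, hg2⟩, hg3⟩ := hgood
    refine hω (norm_sub_le_of_isDepthMaximizer hσ h0 h1 ht hR ?_ hg1 hg2 hδ hg3)
    rw [hRt]
    exact mul_le_of_le_one_left hσ.le hsmall
  · rw [add_zero, ← ENNReal.ofReal_add (by positivity) (by positivity), add_halves]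

end Main

/-! ### The two choices of truncation level -/

/-- Since exp(t²) ≤ ρ^(-0.4), the product is at most ρ^(0.1), the fifth root of √ρ; hence the fifth
power of b. -/
theorem sqrt_mul_exp_sq_le_of_le_sqrt_log {ρ t b : ℝ} (hρ : 0 < ρ) (hb : 0 < b)
    (ht0 : 0 < t) (ht : t ≤ √(0.4 * Real.log ρ⁻¹)) (hρb : √ρ ≤ b ^ 5) :
    √ρ * Real.exp (t ^ 2) ≤ b := by
  have ht2 : t ^ 2 ≤ 0.4 * Real.log ρ⁻¹ := (Real.le_sqrt' ht0).1 ht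
  have hr : 0 < √ρ := Real.sqrt_pos.2 hρ
  have hlog : Real.log ρ⁻¹ = -2 * Real.log √ρ := by
    rw [Real.log_inv, Real.log_sqrt hρ.le]; ring
  have hlb : Real.log √ρ ≤ 5 * Real.log b := by
    have := Real.log_le_log hr hρb
    rwa [Real.log_pow] at this
  calc √ρ * Real.exp (t ^ 2) = Real.exp (Real.log √ρ + t ^ 2) := by
        rw [Real.exp_add, Real.exp_log hr]
    _ ≤ Real.exp (Real.log b) := by
        rw [Real.exp_le_exp]
        rw [hlog] at ht2
        linarith
    _ = b := Real.exp_log hb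

/-- With s = nε²/p and r² = p/n, r² exp(2t²) ≤ r²(s + e) = ε² + e r². The crude bound 2t² ≤ log(s +
e) is enough. -/
theorem mul_exp_sq_le_of_eq_sqrt_log {r ε s t : ℝ} (hr : 0 ≤ r) (hε : 0 ≤ ε) (hs : 0 ≤ s)
    (hrs : r ^ 2 * s = ε ^ 2) (ht : t = 1 / 2 * √(Real.log (s + Real.exp 1))) :
    r * Real.exp (t ^ 2) ≤ ε + 2 * r := by
  have hpos : 0 < s + Real.exp 1 := by positivity
  have hlog : 0 ≤ Real.log (s + Real.exp 1) :=
    Real.log_nonneg (by linarith [Real.add_one_le_exp (1 : ℝ)])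
  have ht2 : t ^ 2 + t ^ 2 ≤ Real.log (s + Real.exp 1) := by
    rw [ht, mul_pow, Real.sq_sqrt hlog]; linarith
  have h1 : Real.exp (t ^ 2) ^ 2 ≤ s + Real.exp 1 := by
    rw [sq, ← Real.exp_add, ← Real.exp_log hpos, Real.exp_le_exp]
    simpa only [Real.exp_log hpos] using ht2
  refine (pow_le_pow_iff_left₀ (by positivity) (by positivity) two_ne_zero).1 ?_
  calc (r * Real.exp (t ^ 2)) ^ 2 = r ^ 2 * Real.exp (t ^ 2) ^ 2 := by ring
    _ ≤ r ^ 2 * (s + Real.exp 1) := by gcongr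
    _ = ε ^ 2 + r ^ 2 * Real.exp 1 := by rw [mul_add, hrs]
    _ ≤ ε ^ 2 + r ^ 2 * 4 := by gcongr; linarith [Real.exp_one_lt_d9]
    _ ≤ (ε + 2 * r) ^ 2 := by nlinarith [mul_nonneg hε hr]

theorem theorem3p1 (α : ℝ) (hα0 : 0 < α) (hα1 : α < 1) :
    ∃ C c : ℝ, 0 < C ∧ 0 < c ∧
      ∀ (n p : ℕ), 0 < n → 0 < p →
      ∀ (β : EuclideanSpace ℝ (Fin p)) (σ ε : ℝ), 0 < σ → 0 ≤ ε → ε < 1 / 2 →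
      Real.sqrt ((p : ℝ) / n) + ε ≤ c →
      ∀ (Q : Kernel (EuclideanSpace ℝ (Fin p)) ℝ) [IsMarkovKernel Q]
        {Ω : Type*} [MeasurableSpace Ω] (μ : Measure Ω) [IsProbabilityMeasure μ]
        (X : Fin n → Ω → EuclideanSpace ℝ (Fin p)) (y : Fin n → Ω → ℝ),
      IsAdaptiveSample μ β σ ε Q X y →
        (∀ t : ℝ, 0 < t → t ≤ Real.sqrt (0.4 * Real.log ((n : ℝ) / p)) →
          ∀ βhat : Ω → EuclideanSpace ℝ (Fin p),
            (∀ᵐ ω ∂μ, IsDepthMaximizer (fun i => X i ω) (fun i => y i ω) t (βhat ω)) →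
            μ {ω | ¬ ‖βhat ω - β‖ ≤
                C * (σ / t) * (Real.sqrt ((p : ℝ) / n) * Real.exp (t ^ 2) + ε)}
              ≤ ENNReal.ofReal α) ∧
        (∀ t : ℝ, t = 1 / 2 * Real.sqrt (Real.log (n * ε ^ 2 / p + Real.exp 1)) →
          ∀ βhat : Ω → EuclideanSpace ℝ (Fin p),
            (∀ᵐ ω ∂μ, IsDepthMaximizer (fun i => X i ω) (fun i => y i ω) t (βhat ω)) →
            μ {ω | ¬ ‖βhat ω - β‖ ≤
                C * (σ * (Real.sqrt ((p : ℝ) / n)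
                  + ε / Real.sqrt (Real.log (n * ε ^ 2 / p + Real.exp 1))))}
              ≤ ENNReal.ofReal α) := by
  obtain ⟨C, hC1, hC⟩ := exists_measure_depth_error_le hα0
  have hC0 : 0 < C := by linarith
  -- Chosen so that C(b + b) = 1, the smallness required by the fixed-level bound.
  set b : ℝ := 1 / (2 * C) with hb
  have hb0 : 0 < b := by positivity
  have hCb : C * b = 1 / 2 := by rw [hb]; field_simp
  have hb1 : b ≤ 1 := by nlinarith
  have hb5 : b ^ 5 ≤ b := pow_le_of_le_one hb0.le hb1 (by norm_num)
  refine ⟨4 * C, b ^ 5, by positivity, by positivity, ?_⟩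
  intro n p hn hp β σ ε hσ h0 h1 hc Q _ Ω _ μ _ X y hsample
  have hn' : (0 : ℝ) < n := by exact_mod_cast hn
  have hp' : (0 : ℝ) < p := by exact_mod_cast hp
  set r : ℝ := √((p : ℝ) / n) with hr
  have hr0 : 0 < r := Real.sqrt_pos.2 (by positivity)
  have hr2 : r ^ 2 = p / n := Real.sq_sqrt (by positivity)
  have hpn : p ≤ n := by
    have h2 : (p : ℝ) / n ≤ 1 := by rw [← hr2]; exact pow_le_one₀ hr0.le (by linarith)
    exact_mod_cast (div_le_one hn').1 h2
  refine ⟨fun t ht0 ht βhat hmax => ?_, fun t ht βhat hmax => ?_⟩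
  · have hexp : r * Real.exp (t ^ 2) ≤ b := by
      refine sqrt_mul_exp_sq_le_of_le_sqrt_log (by positivity) hb0 ht0 ?_ (by linarith)
      rwa [inv_div]
    have key := hC n p hp hpn β σ ε hσ h0 h1 Q μ X y hsample t ht0 (by
      calc C * (r * Real.exp (t ^ 2) + ε) ≤ C * (b + b) := by gcongr; linarith
        _ = 1 := by linarith) βhat hmax
    refine (measure_mono (Set.ofPred_subset_ofPred.2 fun ω hω hle => hω (hle.trans ?_))).trans key
    gcongr
    linarith
  · set s : ℝ := n * ε ^ 2 / p with hs
    have hs0 : 0 ≤ s := by positivity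
    set ℓ : ℝ := √(Real.log (s + Real.exp 1)) with hℓ
    -- The summand e in the logarithm ensures this, so that r / ℓ ≤ r at the end. The constant 4C
    -- comes from 1 / t = 2 / ℓ and from bounding the rate by 2(r + ε).
    have hℓ1 : 1 ≤ ℓ := by
      rw [hℓ, Real.one_le_sqrt, Real.le_log_iff_exp_le (by positivity)]
      linarith
    have hℓ0 : 0 < ℓ := by linarith
    have ht0 : 0 < t := by rw [ht]; positivity
    have hrs : r ^ 2 * s = ε ^ 2 := by rw [hr2, hs]; field_simp
    have hexp := mul_exp_sq_le_of_eq_sqrt_log hr0.le h0 hs0 hrs ht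
    have key := hC n p hp hpn β σ ε hσ h0 h1 Q μ X y hsample t ht0 (by
      calc C * (r * Real.exp (t ^ 2) + ε) ≤ C * (2 * b) := by gcongr; linarith
        _ = 1 := by linarith) βhat hmax
    refine (measure_mono (Set.ofPred_subset_ofPred.2 fun ω hω hle => hω (hle.trans ?_))).trans key
    calc C * (σ / t) * (r * Real.exp (t ^ 2) + ε) ≤ C * (σ / t) * (2 * r + 2 * ε) := by
          exact mul_le_mul_of_nonneg_left (by linarith) (by positivity)
      _ = 4 * C * (σ * (r / ℓ + ε / ℓ)) := by rw [ht]; field_simp; ring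
      _ ≤ 4 * C * (σ * (r + ε / ℓ)) := by
          gcongr
          exact div_le_self hr0.le hℓ1

end
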